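/- For $n\ge 2$ let $\mathcal F_n$ be the set of functions $f:\{2,\dots,n-1\}\to\{1,\dots,n\}$, let $\mathrm{graph}(f)$ be the digraph on $\{1,\dots,n\}$ with the edges $\langle i,f(i)\rangle$, $2\le i\le n-1$, and let $\vec C_{n,1}$ be the set of directed trees on $\{1,\dots,n\}$ rooted at $1$, with all edges directed towards the root. Let $m_1>\dots>m_a$ be the maximum elements of the directed cycles of $\mathrm{graph}(f)$ (loops included), and put $l_i=f(m_i)$. The digraph $\Theta(f)$ is obtained from $\mathrm{graph}(f)$ by deleting the edges $(m_i,l_i)$, $1\le i\le a$, and adding the edges $(n,l_1)$, $(m_i,l_{i+1})$ for $1\le i<a$, and $(m_a,1)$; if there are no cycles, only the edge $(n,1)$ is added. Theorem. For every $n\ge2$, $\Theta$ is a bijection $\mathcal F_n\to\vec C_{n,1}$, and both $\Theta$ and $\Theta^{-1}$ can be computed in linear time. Precisely, there are two programs $P,Q$ for a unit-cost random access machine (with the operations: load a constant, addition, truncated subtraction, indirect load and store, jumps and conditional jumps on $<$ and $=$) and a constant $C$, all independent of $n$, such that for all $n\ge 2$: (1) for every $f\in\mathcal F_n$, given $n$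 and a list, in any order, of the pairs $\langle i,f(i)\rangle$, $2\le i\le n-1$, the program $P$ halts after at most $Cn$ steps with $n$ and the list of the edges $\langle i,t_i\rangle$, $2\le i\le n$, of $\Theta(f)$, in increasing order of $i$, in memory; (2) for every $T\in\vec C_{n,1}$, given $n$ and a list, in any order, of the edges $\langle i,t_i\rangle$ of $T$, the program $Q$ halts after at most $Cn$ steps with $n$ and the list of the pairs $\langle i,f(i)\rangle$, $2\le i\le n-1$, where $f=\Theta^{-1}(T)$, in increasing order of $i$, in memory. Moreover, during these computations no register and no memory cell ever holds a number larger than $Cn$. -/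

import Mathlib

namespace CayleyRAM

/-! ### Functions, directed trees, and the map `Θ` -/

/-- The vertex set `[n] = {1, …, n}`. -/
abbrev Vertex (n : ℕ) : Type := {i : ℕ // 1 ≤ i ∧ i ≤ n}

/-- The common domain `{2, …, n - 1}` of the functions in `𝓕ₙ`. -/
abbrev Inner (n : ℕ) : Type := {i : ℕ // 2 ≤ i ∧ i < n}

/-- The class `𝓕ₙ` of functions `{2, …, n - 1} → {1, …, n}`. -/
abbrev FunClass (n : ℕ) : Type := Inner n → Vertex n

/-- `graph(f)`: the digraph on `[n]` with the edges `⟨i, f(i)⟩`, `2 ≤ i ≤ n - 1`. -/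
def graph {n : ℕ} (f : FunClass n) : Digraph (Vertex n) where
  Adj v w := ∃ i : Inner n, i.1 = v.1 ∧ f i = w

/-- `T` is a directed tree on `[n]` with root `1` and all edges directed towards the root: no edge
leaves `1`, exactly one edge leaves every other vertex, and every vertex has a directed path
to `1`. -/
structure IsTreeRootedAtOne {n : ℕ} (T : Digraph (Vertex n)) : Prop where
  root_out : ∀ v : Vertex n, v.1 = 1 → ∀ w, ¬ T.Adj v w
  unique_out : ∀ v : Vertex n, v.1 ≠ 1 → ∃! w, T.Adj v w
  reach_root : ∀ v r : Vertex n, r.1 = 1 → Relation.ReflTransGen T.Adj v r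

/-- The set of directed trees on `[n]` that are rooted at `1`. -/
def rootedTrees (n : ℕ) : Set (Digraph (Vertex n)) := {T | IsTreeRootedAtOne T}

section Theta

variable {n : ℕ} (f : FunClass n)

/-- `v` and `w` lie on a common directed cycle of `graph(f)` (cycles of length one included). -/
def SameCycle (v w : Vertex n) : Prop :=
  Relation.TransGen (graph f).Adj v w ∧ Relation.TransGen (graph f).Adj w v

/-- `r` is the right endpoint, that is, the maximum element, of a cycle of `graph(f)`. -/
def IsRightEnd (r : Vertex n) : Prop :=
  SameCycle f r r ∧ ∀ w, SameCycle f r w → w ≤ r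

/-- `(r, l)` is the back edge of a cycle of `graph(f)`: it leads from the right endpoint `r` of the
cycle to its left endpoint `l`. -/
def IsBackEdge (r l : Vertex n) : Prop :=
  IsRightEnd f r ∧ (graph f).Adj r l

/-- The cycle with right endpoint `r` is the first one (cycles are listed by decreasing maxima). -/
def IsFirstCycle (r : Vertex n) : Prop :=
  IsRightEnd f r ∧ ∀ s, IsRightEnd f s → s ≤ r

/-- The cycle with right endpoint `r` is the last one. -/
def IsLastCycle (r : Vertex n) : Prop :=
  IsRightEnd f r ∧ ∀ s, IsRightEnd f s → r ≤ s

/-- The cycle with right endpoint `s` follows immediately the one with right endpoint `r`. -/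
def IsNextCycle (r s : Vertex n) : Prop :=
  IsRightEnd f r ∧ IsRightEnd f s ∧ s < r ∧ ∀ u, IsRightEnd f u → ¬ (s < u ∧ u < r)

/-- The digraph `Θ(f)`: the back edges of `graph(f)` are deleted; an edge is added from the right
endpoint of each cycle to the left endpoint of the next one, from `n` to the left endpoint of the
first cycle, and from the right endpoint of the last cycle to `1`. If there are no cycles, the
edge `(n, 1)` is added. -/
def theta : Digraph (Vertex n) where
  Adj v w :=
    ((graph f).Adj v w ∧ ¬ IsBackEdge f v w) ∨
    (∃ s, IsNextCycle f v s ∧ IsBackEdge f s w) ∨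
    (v.1 = n ∧ ∃ s, IsFirstCycle f s ∧ IsBackEdge f s w) ∨
    (IsLastCycle f v ∧ w.1 = 1) ∨
    ((∀ s, ¬ IsRightEnd f s) ∧ v.1 = n ∧ w.1 = 1)

end Theta

/-! ### Random access machines with unit cost -/

/-- The instructions of the machine. Its words are natural numbers; it has registers
`R 0, R 1, …` (a program names only finitely many of them) and a memory `M 0, M 1, …`. -/
inductive Instr : Type
  /-- `R d := c` -/
  | const (d c : ℕ)
  /-- `R d := R a + R b` -/
  | add (d a b : ℕ)
  /-- `R d := max (R a - R b) 0` -/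
  | sub (d a b : ℕ)
  /-- `R d := M (R a)` -/
  | load (d a : ℕ)
  /-- `M (R a) := R b` -/
  | store (a b : ℕ)
  /-- go to instruction number `l` -/
  | jump (l : ℕ)
  /-- go to instruction number `l` if `R a < R b` -/
  | jumpLt (a b l : ℕ)
  /-- go to instruction number `l` if `R a = R b` -/
  | jumpEq (a b l : ℕ)

/-- A program is a finite list of instructions, numbered from `0`. -/
abbrev Program : Type := List Instr

/-- A configuration: program counter, registers, memory. -/
structure Config : Type where
  pc : ℕ
  reg : ℕ → ℕ
  mem : ℕ → ℕ

/-- The effect of a single instruction. -/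
def Instr.exec (c : Config) : Instr → Config
  | .const d k => ⟨c.pc + 1, Function.update c.reg d k, c.mem⟩
  | .add d a b => ⟨c.pc + 1, Function.update c.reg d (c.reg a + c.reg b), c.mem⟩
  | .sub d a b => ⟨c.pc + 1, Function.update c.reg d (c.reg a - c.reg b), c.mem⟩
  | .load d a => ⟨c.pc + 1, Function.update c.reg d (c.mem (c.reg a)), c.mem⟩
  | .store a b => ⟨c.pc + 1, c.reg, Function.update c.mem (c.reg a) (c.reg b)⟩
  | .jump l => ⟨l, c.reg, c.mem⟩
  | .jumpLt a b l => ⟨if c.reg a < c.reg b then l else c.pc + 1, c.reg, c.mem⟩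
  | .jumpEq a b l => ⟨if c.reg a = c.reg b then l else c.pc + 1, c.reg, c.mem⟩

/-- The machine has halted when the program counter has left the program. -/
def Halted (P : Program) (c : Config) : Prop := P.length ≤ c.pc

/-- One step: one instruction is executed. A halted configuration does not change. -/
def step (P : Program) (c : Config) : Config :=
  match P[c.pc]? with
  | none => c
  | some ins => ins.exec c

/-- The initial configuration: the input words stand in the memory from address `0` on, and
everything else is zero. -/
def initial (input : List ℕ) : Config := ⟨0, fun _ => 0, fun i => input.getD i 0⟩

/-- `P`, started on `input`, halts after at most `t` steps with the words of `output` in the memory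
from address `0` on, and no register and no memory cell ever holds a number exceeding `W`. -/
def RunsTo (P : Program) (input output : List ℕ) (t W : ℕ) : Prop :=
  ∃ k ≤ t, Halted P ((step P)^[k] (initial input)) ∧
    (∀ i (hi : i < output.length), ((step P)^[k] (initial input)).mem i = output[i]) ∧
    ∀ j ≤ k, ∀ i, ((step P)^[j] (initial input)).reg i ≤ W ∧
      ((step P)^[j] (initial input)).mem i ≤ W

/-! ### Digraphs as lists of pairs -/

/-- `L` lists the edges `⟨i, j⟩` of `G`, each exactly once, in an arbitrary order. -/
def IsEdgeList {n : ℕ} (G : Digraph (Vertex n)) (L : List (ℕ × ℕ)) : Prop :=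
  L.Nodup ∧ ∀ p : ℕ × ℕ, p ∈ L ↔ ∃ v w : Vertex n, G.Adj v w ∧ p = (v.1, w.1)

/-- The words `n, i₁, j₁, i₂, j₂, …` that represent `n` and the list `⟨i₁, j₁⟩, ⟨i₂, j₂⟩, …`. -/
def encode (n : ℕ) (L : List (ℕ × ℕ)) : List ℕ := n :: L.flatMap fun p => [p.1, p.2]

/-- Given any list of the edges of `G`, the program `P` produces the list of the edges of `H`,
ordered by initial vertices, in at most `t` steps on words that are at most `W`. -/
def Computes (P : Program) {n : ℕ} (G H : Digraph (Vertex n)) (t W : ℕ) : Prop :=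
  ∀ L, IsEdgeList G L → ∃ L', IsEdgeList H L' ∧ L'.Pairwise (fun p q => p.1 < q.1) ∧
    RunsTo P (encode n L) (encode n L') t W

end CayleyRAM

namespace CayleyRAM

/-! ### A structured language on top of the machine -/

/-! Extend `f` by `n ↦ 1`, `1 ↦ 0`, `0 ↦ 0` and by `0` beyond `n`; every edge becomes one step of a
map `g`. Consider pairs `(g, p)` for which `n` leads to `p`, `g p = 1`, and all vertices on cycles
are smaller than `p` (`Good`); at the beginning `p = n`. If `m` is the largest vertex on a cycle,
redirect `p` to `g m` and `m` to `1` (`Splice`). The cycle of `m` is thereby opened and put at the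
end of the path from `n` to `1`, and `(g', m)` is again such a pair. As `p` decreases, this stops at
a map without cycles, and its digraph is `Θ(f)` (`theta_eq_digraphOf`); without cycles every orbit
runs to `1`, so the digraph is a tree.

The step can be undone: the vertices after `p` on the new path are at most `m`, while `m < p`, so
`p` is the last vertex larger than `m` (`Splice.left_unique`). Hence the final pair determines the
first one, which gives injectivity. For surjectivity, start from a tree and cut repeatedly behind
the last vertex that exceeds the present `p` (`Good.cut`), until `p = n`. The cycle maxima are thus
recovered as the right-to-left maxima of the path.

For the running time, a small structured language is compiled to the machine, with rules that bound
time and word size together (`Runs`, `wp`). Each algorithm is a sequence of loops with bodies of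
constant size, so a linear bound on a decreasing measure suffices. `Θ` needs the vertices on cycles,
found by a colouring search, and one downward scan for the maxima; a cycle that has been spliced in
is unmarked during the scan. The inverse puts the path on a stack and scans it from its end. -/

/-- Every register and every memory cell of `c` holds a number that is at most `W`. -/
def Bounded (W : ℕ) (c : Config) : Prop := ∀ i, c.reg i ≤ W ∧ c.mem i ≤ W

/-- `k` steps lead from `c` to `c'` through configurations that are bounded by `W`. -/
def Trace (P : Program) (W k : ℕ) (c c' : Config) : Prop :=
  (step P)^[k] c = c' ∧ ∀ j ≤ k, Bounded W ((step P)^[j] c)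

theorem Trace.refl {P : Program} {W : ℕ} {c : Config} (h : Bounded W c) : Trace P W 0 c c :=
  ⟨rfl, fun j hj => by rw [Nat.le_zero.1 hj]; exact h⟩

theorem Trace.trans {P : Program} {W k l : ℕ} {c c' c'' : Config} (h : Trace P W k c c')
    (h' : Trace P W l c' c'') : Trace P W (k + l) c c'' := by
  obtain ⟨h1, h2⟩ := h
  obtain ⟨h3, h4⟩ := h'
  refine ⟨by rw [Nat.add_comm, Function.iterate_add_apply, h1, h3], fun j hj => ?_⟩
  rcases le_total j k with h5 | h5
  · exact h2 j h5
  · obtain ⟨d, rfl⟩ := Nat.exists_eq_add_of_le h5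
    rw [Nat.add_comm, Function.iterate_add_apply, h1]
    exact h4 d (by omega)

theorem Trace.single {P : Program} {W : ℕ} {c : Config} {ins : Instr} (hc : Bounded W c)
    (hins : P[c.pc]? = some ins) (h : Bounded W (ins.exec c)) :
    Trace P W 1 c (ins.exec c) := by
  have hs : step P c = ins.exec c := by simp [step, hins]
  refine ⟨hs, fun j hj => ?_⟩
  interval_cases j
  · exact hc
  · simpa [hs] using h

/-- The instructions `l` stand in the program `P` from position `o` on. -/
def Placed (P : Program) (o : ℕ) (l : List Instr) : Prop :=
  ∀ i x, l[i]? = some x → P[o + i]? = some x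

theorem placed_cons {P : Program} {o : ℕ} {x : Instr} {l : List Instr} :
    Placed P o (x :: l) ↔ P[o]? = some x ∧ Placed P (o + 1) l := by
  constructor
  · intro h
    refine ⟨h 0 x rfl, fun i y hy => ?_⟩
    have := h (i + 1) y (by simpa using hy)
    rwa [Nat.add_assoc, Nat.add_comm 1 i]
  · rintro ⟨h1, h2⟩ i y hy
    cases i with
    | zero => simpa using h1.trans (by simpa using hy)
    | succ i =>
      have := h2 i y (by simpa using hy)
      rwa [Nat.add_assoc, Nat.add_comm 1 i] at this

theorem placed_append {P : Program} {o : ℕ} {l l' : List Instr} :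
    Placed P o (l ++ l') ↔ Placed P o l ∧ Placed P (o + l.length) l' := by
  induction l generalizing o with
  | nil => simp [Placed]
  | cons x l ih =>
    rw [List.cons_append, placed_cons, placed_cons, ih, and_assoc, List.length_cons,
      Nat.add_assoc, Nat.add_comm 1]

/-- Commands of a structured language with variables `0, 1, …` and arrays `0, 1, …`. -/
inductive Cmd : Type
  | nop
  | set (d c : ℕ)
  | add (d a b : ℕ)
  | sub (d a b : ℕ)
  | rd (d k a : ℕ)
  | wr (k a b : ℕ)
  | seq (p q : Cmd)
  | ifLt (a b : ℕ) (p q : Cmd)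
  | ifEq (a b : ℕ) (p q : Cmd)
  | whileLt (a b : ℕ) (p : Cmd)

/-- A sequence of commands. -/
def Cmd.block : List Cmd → Cmd
  | [] => .nop
  | c :: l => .seq c (block l)

/-- Put the address of entry number `var a` of array `k` into register `1`. -/
def addrCode (k a : ℕ) : List Instr :=
  .const 1 0 :: .add 1 1 (2 * a) :: List.replicate k (.add 1 1 3)

/-- The number of instructions that a command is translated to. -/
def Cmd.size : Cmd → ℕ
  | .nop => 0
  | .set _ _ => 1
  | .add _ _ _ => 1
  | .sub _ _ _ => 1
  | .rd _ k _ => k + 3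
  | .wr k _ _ => k + 3
  | .seq p q => p.size + q.size
  | .ifLt _ _ p q => p.size + q.size + 2
  | .ifEq _ _ p q => p.size + q.size + 2
  | .whileLt _ _ p => p.size + 3

/-- The translation of a command into instructions that are to be placed at position `o`. -/
def Cmd.code : Cmd → ℕ → List Instr
  | .nop, _ => []
  | .set d c, _ => [.const (2 * d) c]
  | .add d a b, _ => [.add (2 * d) (2 * a) (2 * b)]
  | .sub d a b, _ => [.sub (2 * d) (2 * a) (2 * b)]
  | .rd d k a, _ => addrCode k a ++ [.load (2 * d) 1]
  | .wr k a b, _ => addrCode k a ++ [.store 1 (2 * b)]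
  | .seq p q, o => p.code o ++ q.code (o + p.size)
  | .ifLt a b p q, o => .jumpLt (2 * a) (2 * b) (o + q.size + 2) ::
      (q.code (o + 1) ++ .jump (o + q.size + 2 + p.size) :: p.code (o + q.size + 2))
  | .ifEq a b p q, o => .jumpEq (2 * a) (2 * b) (o + q.size + 2) ::
      (q.code (o + 1) ++ .jump (o + q.size + 2 + p.size) :: p.code (o + q.size + 2))
  | .whileLt a b p, o => .jumpLt (2 * a) (2 * b) (o + 2) :: .jump (o + p.size + 3) ::
      (p.code (o + 2) ++ [.jump o])

theorem Cmd.length_code (c : Cmd) (o : ℕ) : (c.code o).length = c.size := by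
  induction c generalizing o <;> simp_all [Cmd.code, Cmd.size, addrCode] <;> omega

/-- The values of the variables and of the arrays. -/
structure Store : Type where
  var : ℕ → ℕ
  arr : ℕ → ℕ → ℕ

/-- Assign to a variable. -/
def Store.setVar (s : Store) (d x : ℕ) : Store := ⟨Function.update s.var d x, s.arr⟩

/-- Assign to an array entry. -/
def Store.setArr (s : Store) (k i x : ℕ) : Store :=
  ⟨s.var, Function.update s.arr k (Function.update (s.arr k) i x)⟩

/-- The configuration `c` represents the store `s`: variables are kept in the registers with even
numbers, arrays have length `N` and are kept in the memory one after the other. -/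
structure Represents (N W : ℕ) (s : Store) (c : Config) : Prop where
  var : ∀ v, c.reg (2 * v) = s.var v
  len : c.reg 3 = N
  arr : ∀ k i, i < N → c.mem (k * N + i) = s.arr k i
  bdd : Bounded W c

/-- Wherever the code of `p` is placed, it transforms the store `s` in at most `T` steps into a
store with the property `Q`. -/
def Runs (N W : ℕ) (p : Cmd) (s : Store) (T : ℕ) (Q : Store → Prop) : Prop :=
  ∀ (P : Program) (c : Config), Placed P c.pc (p.code c.pc) → Represents N W s c →
    ∃ k ≤ T, ∃ c' s', Trace P W k c c' ∧ c'.pc = c.pc + p.size ∧ Represents N W s' c' ∧ Q s'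

variable {N W : ℕ}

/-! ### Rules for the effect and the running time of commands -/

theorem Runs.mono {p : Cmd} {s : Store} {T T' : ℕ} {Q Q' : Store → Prop} (h : Runs N W p s T Q)
    (hT : T ≤ T') (hQ : ∀ s', Q s' → Q' s') : Runs N W p s T' Q' := by
  intro P c h1 h2
  obtain ⟨k, hk, c', s', h3, h4, h5, h6⟩ := h P c h1 h2
  exact ⟨k, hk.trans hT, c', s', h3, h4, h5, hQ s' h6⟩

theorem Runs.seq {p q : Cmd} {s : Store} {T T' : ℕ} {Q Q' : Store → Prop}
    (h : Runs N W p s T Q) (h' : ∀ s', Q s' → Runs N W q s' T' Q') :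
    Runs N W (.seq p q) s (T + T') Q' := by
  intro P c h1 h2
  rw [Cmd.code, placed_append, Cmd.length_code] at h1
  obtain ⟨k, hk, c', s', h3, h4, h5, h6⟩ := h P c h1.1 h2
  obtain ⟨l, hl, c'', s'', h7, h8, h9, h10⟩ := h' s' h6 P c' (by rw [h4]; exact h1.2) h5
  exact ⟨k + l, by omega, c'', s'', h3.trans h7, by rw [h8, h4, Cmd.size]; omega, h9, h10⟩

theorem Runs.nop {s : Store} {Q : Store → Prop} (h : Q s) : Runs N W .nop s 0 Q :=
  fun _ c _ h2 => ⟨0, le_rfl, c, s, Trace.refl h2.bdd, rfl, h2, h⟩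

theorem Bounded.update_reg {c : Config} (h : Bounded W c) {pc d x : ℕ} (hx : x ≤ W) :
    Bounded W ⟨pc, Function.update c.reg d x, c.mem⟩ := by
  intro i
  refine ⟨?_, (h i).2⟩
  by_cases hi : i = d
  · subst hi; simpa using hx
  · simpa [hi] using (h i).1

/-- Variables occupy the even registers only, so assignments leave the array length in register `3`
alone. -/
theorem Represents.setVar {s : Store} {c : Config} (h : Represents N W s c) {pc d x : ℕ}
    (hx : x ≤ W) :
    Represents N W (s.setVar d x) ⟨pc, Function.update c.reg (2 * d) x, c.mem⟩ := by
  refine ⟨fun v => ?_, ?_, h.arr, h.bdd.update_reg hx⟩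
  · by_cases hv : v = d
    · subst hv; simp [Store.setVar]
    · simp [Store.setVar, hv, h.var]
  · simp only [Function.update_apply]
    rw [if_neg (by omega), h.len]

theorem Represents.setScratch {s : Store} {c : Config} (h : Represents N W s c) {pc x : ℕ}
    (hx : x ≤ W) :
    Represents N W s ⟨pc, Function.update c.reg 1 x, c.mem⟩ := by
  refine ⟨fun v => ?_, by simpa using h.len, h.arr, h.bdd.update_reg hx⟩
  simp only [Function.update_apply]
  rw [if_neg (by omega), h.var]

theorem Represents.setPc {s : Store} {c : Config} (h : Represents N W s c) {pc : ℕ} :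
    Represents N W s ⟨pc, c.reg, c.mem⟩ := ⟨h.var, h.len, h.arr, h.bdd⟩

/-- Arrays do not overlap: from an address `k * N + i` with `i < N`, division by `N` recovers `k`.
-/
theorem Represents.setArr {s : Store} {c : Config} (h : Represents N W s c) {pc k i x : ℕ}
    (hi : i < N) (hx : x ≤ W) :
    Represents N W (s.setArr k i x) ⟨pc, c.reg, Function.update c.mem (k * N + i) x⟩ := by
  refine ⟨h.var, h.len, fun k' i' hi' => ?_, fun j => ⟨(h.bdd j).1, ?_⟩⟩
  · by_cases hk : k' = k
    · subst hk
      simp only [Store.setArr, Function.update_self, Function.update_apply,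
        Nat.add_left_cancel_iff]
      split_ifs
      · rfl
      · exact h.arr _ _ hi'
    · have : k' * N + i' ≠ k * N + i := by
        intro he
        apply hk
        have h1 : (k' * N + i') / N = k' := by
          rw [Nat.mul_comm, Nat.mul_add_div (by omega), Nat.div_eq_of_lt hi', Nat.add_zero]
        have h2 : (k * N + i) / N = k := by
          rw [Nat.mul_comm, Nat.mul_add_div (by omega), Nat.div_eq_of_lt hi, Nat.add_zero]
        rw [← h1, he, h2]
      simp [Store.setArr, this, hk, h.arr _ _ hi']
  · simp only [Function.update_apply]
    split_ifs
    · exact hx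
    · exact (h.bdd j).2

theorem Represents.var_le {s : Store} {c : Config} (h : Represents N W s c) (v : ℕ) :
    s.var v ≤ W := h.var v ▸ (h.bdd _).1

theorem Represents.arr_le {s : Store} {c : Config} (h : Represents N W s c) (k : ℕ) {i : ℕ}
    (hi : i < N) : s.arr k i ≤ W := h.arr k i hi ▸ (h.bdd _).2

theorem Runs.set {s : Store} {d x : ℕ} {Q : Store → Prop} (hx : x ≤ W) (h : Q (s.setVar d x)) :
    Runs N W (.set d x) s 1 Q := by
  intro P c h1 h2
  simp only [Cmd.code, placed_cons] at h1
  have h3 := h2.setVar (pc := c.pc + 1) (d := d) hx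
  exact ⟨1, le_rfl, _, _, Trace.single h2.bdd h1.1 h3.bdd, rfl, h3, h⟩

theorem Runs.add {s : Store} {d a b : ℕ} {Q : Store → Prop} (hx : s.var a + s.var b ≤ W)
    (h : Q (s.setVar d (s.var a + s.var b))) : Runs N W (.add d a b) s 1 Q := by
  intro P c h1 h2
  simp only [Cmd.code, placed_cons] at h1
  have h3 := h2.setVar (pc := c.pc + 1) (d := d) hx
  rw [← h2.var a, ← h2.var b] at h3 h
  exact ⟨1, le_rfl, _, _, Trace.single h2.bdd h1.1 h3.bdd, rfl, h3, h⟩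

theorem Runs.sub {s : Store} {d a b : ℕ} {Q : Store → Prop}
    (h : Q (s.setVar d (s.var a - s.var b))) : Runs N W (.sub d a b) s 1 Q := by
  intro P c h1 h2
  simp only [Cmd.code, placed_cons] at h1
  have h3 := h2.setVar (pc := c.pc + 1) (d := d) (x := s.var a - s.var b)
    ((Nat.sub_le _ _).trans (h2.var_le a))
  rw [← h2.var a, ← h2.var b] at h3 h
  exact ⟨1, le_rfl, _, _, Trace.single h2.bdd h1.1 h3.bdd, rfl, h3, h⟩

/-- The machine has no multiplication; the offset `k * N` is accumulated by `k` additions. Since `k`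
is fixed by the program, the cost is constant, and the bound on the final value covers all
intermediate ones. -/
theorem trace_replicate {P : Program} {s : Store} {c : Config} (k : ℕ)
    (h1 : Placed P c.pc (List.replicate k (.add 1 1 3))) (h2 : Represents N W s c)
    (h : k * N + c.reg 1 ≤ W) :
    ∃ c', Trace P W k c c' ∧ c'.pc = c.pc + k ∧ Represents N W s c' ∧
      c'.reg 1 = k * N + c.reg 1 := by
  induction k generalizing c with
  | zero => exact ⟨c, Trace.refl h2.bdd, rfl, h2, by simp⟩
  | succ k ih =>
    rw [List.replicate_succ, placed_cons] at h1
    rw [Nat.succ_mul] at h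
    have h3 := h2.setScratch (pc := c.pc + 1) (x := c.reg 1 + c.reg 3) (by rw [h2.len]; omega)
    have h4 := Trace.single h2.bdd h1.1 h3.bdd
    obtain ⟨c', h5, h6, h7, h8⟩ := ih h1.2 h3 (by simp only [Function.update_self, h2.len]; omega)
    refine ⟨c', Nat.add_comm k 1 ▸ h4.trans h5, by rw [h6]; simp only; omega, h7, ?_⟩
    rw [h8, Nat.succ_mul]
    simp only [Function.update_self, h2.len]
    omega

theorem trace_addrCode {P : Program} {s : Store} {c : Config} (k a : ℕ)
    (h1 : Placed P c.pc (addrCode k a)) (h2 : Represents N W s c)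
    (h : k * N + s.var a ≤ W) :
    ∃ c', Trace P W (k + 2) c c' ∧ c'.pc = c.pc + (k + 2) ∧ Represents N W s c' ∧
      c'.reg 1 = k * N + s.var a := by
  simp only [addrCode, placed_cons] at h1
  have h3 := h2.setScratch (pc := c.pc + 1) (x := 0) (Nat.zero_le _)
  have h4 := Trace.single h2.bdd h1.1 h3.bdd
  have h5 := h3.setScratch (pc := c.pc + 1 + 1) (x := 0 + s.var a)
    (by have := h2.var_le a; omega)
  rw [← h3.var a] at h5
  have h6 := Trace.single h3.bdd h1.2.1 h5.bdd
  obtain ⟨c', h7, h8, h9, h10⟩ := trace_replicate k h1.2.2 h5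
    (by simp only [Function.update_self]; have := h3.var a; simp only at this; omega)
  refine ⟨c', ?_, by rw [h8]; simp only; omega, h9, ?_⟩
  · have := (h4.trans h6).trans h7
    rwa [show 1 + 1 + k = k + 2 by omega] at this
  · have := h3.var a
    simp only at this
    rw [h10]
    simp only [Function.update_self]
    omega

/-- The hypothesis `(k + 1) * N ≤ W` is there because the address itself passes through a register.
-/
theorem Runs.rd {s : Store} {d k a : ℕ} {Q : Store → Prop} (hk : (k + 1) * N ≤ W)
    (ha : s.var a < N) (h : Q (s.setVar d (s.arr k (s.var a)))) :
    Runs N W (.rd d k a) s (k + 3) Q := by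
  intro P c h1 h2
  rw [Cmd.code, placed_append, placed_cons] at h1
  rw [Nat.succ_mul] at hk
  obtain ⟨c', h3, h4, h5, h6⟩ := trace_addrCode k a h1.1 h2 (by omega)
  have h7 := h5.setVar (pc := c'.pc + 1) (d := d) (h5.arr_le k ha)
  rw [← h5.arr k _ ha, ← h6] at h7 h
  have h8 := h1.2.1
  simp only [addrCode, List.length_cons, List.length_replicate] at h8
  rw [← h4] at h8
  exact ⟨k + 3, le_rfl, _, _, h3.trans (Trace.single h5.bdd h8 h7.bdd),
    by simp only [Instr.exec, Cmd.size]; omega, h7, h⟩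

theorem Runs.wr {s : Store} {k a b : ℕ} {Q : Store → Prop} (hk : (k + 1) * N ≤ W)
    (ha : s.var a < N) (h : Q (s.setArr k (s.var a) (s.var b))) :
    Runs N W (.wr k a b) s (k + 3) Q := by
  intro P c h1 h2
  rw [Cmd.code, placed_append, placed_cons] at h1
  rw [Nat.succ_mul] at hk
  obtain ⟨c', h3, h4, h5, h6⟩ := trace_addrCode k a h1.1 h2 (by omega)
  have h7 := h5.setArr (pc := c'.pc + 1) (k := k) ha (h5.var_le b)
  rw [← h5.var b] at h7 h
  rw [← h6] at h7
  have h8 := h1.2.1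
  simp only [addrCode, List.length_cons, List.length_replicate] at h8
  rw [← h4] at h8
  exact ⟨k + 3, le_rfl, _, _, h3.trans (Trace.single h5.bdd h8 h7.bdd),
    by simp only [Instr.exec, Cmd.size]; omega, h7, h⟩

/-- The two conditional commands at once: a first instruction that jumps if and only if `φ`. -/
theorem runs_branch {p q r : Cmd} {s : Store} {T : ℕ} {Q : Store → Prop} {φ : Prop} [Decidable φ]
    {ins : ℕ → Instr}
    (hins : ∀ (c : Config) (l : ℕ), Represents N W s c →
      (ins l).exec c = ⟨if φ then l else c.pc + 1, c.reg, c.mem⟩)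
    (hcode : ∀ o, r.code o = ins (o + q.size + 2) ::
      (q.code (o + 1) ++ .jump (o + q.size + 2 + p.size) :: p.code (o + q.size + 2)))
    (hsize : r.size = p.size + q.size + 2)
    (hp : φ → Runs N W p s T Q) (hq : ¬ φ → Runs N W q s T Q) : Runs N W r s (T + 2) Q := by
  intro P c h1 h2
  rw [hcode, placed_cons, placed_append, placed_cons, Cmd.length_code] at h1
  obtain ⟨h3, h4, h5, h6⟩ := h1
  have h7 := hins c (c.pc + q.size + 2) h2
  by_cases h : φ
  · rw [if_pos h] at h7
    have h8 := Trace.single h2.bdd h3 (by rw [h7]; exact h2.setPc.bdd)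
    rw [h7] at h8
    obtain ⟨k, hk, c', s', h9, h10, h11, h12⟩ := hp h P _
      (by rwa [show c.pc + 1 + q.size + 1 = c.pc + q.size + 2 by omega] at h6)
      (h2.setPc (pc := c.pc + q.size + 2))
    exact ⟨1 + k, by omega, c', s', h8.trans h9, by rw [h10, hsize]; simp only; omega, h11, h12⟩
  · rw [if_neg h] at h7
    have h8 := Trace.single h2.bdd h3 (by rw [h7]; exact h2.setPc.bdd)
    rw [h7] at h8
    obtain ⟨k, hk, c', s', h9, h10, h11, h12⟩ := hq h P _ h4 (h2.setPc (pc := c.pc + 1))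
    have h13 := Trace.single h11.bdd (by rw [h10]; exact h5) h11.setPc.bdd
    exact ⟨1 + k + 1, by omega, _, s', (h8.trans h9).trans h13,
      by rw [hsize]; simp only [Instr.exec]; omega, h11.setPc, h12⟩

theorem Runs.ifLt {p q : Cmd} {s : Store} {a b T : ℕ} {Q : Store → Prop}
    (hp : s.var a < s.var b → Runs N W p s T Q) (hq : ¬ s.var a < s.var b → Runs N W q s T Q) :
    Runs N W (.ifLt a b p q) s (T + 2) Q :=
  runs_branch (ins := .jumpLt (2 * a) (2 * b))
    (fun c l h => by simp only [Instr.exec, h.var]) (fun _ => rfl) rfl hp hq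

theorem Runs.ifEq {p q : Cmd} {s : Store} {a b T : ℕ} {Q : Store → Prop}
    (hp : s.var a = s.var b → Runs N W p s T Q) (hq : ¬ s.var a = s.var b → Runs N W q s T Q) :
    Runs N W (.ifEq a b p q) s (T + 2) Q :=
  runs_branch (ins := .jumpEq (2 * a) (2 * b))
    (fun c l h => by simp only [Instr.exec, h.var]) (fun _ => rfl) rfl hp hq

/-- A loop with invariant `I` and measure `μ`. -/
theorem Runs.whileLt {p : Cmd} {a b T : ℕ} {I : Store → Prop} {μ : Store → ℕ}
    (h : ∀ s, I s → s.var a < s.var b → Runs N W p s T fun s' => I s' ∧ μ s' < μ s)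
    (m : ℕ) (s : Store) (hm : μ s ≤ m) (hI : I s) :
    Runs N W (.whileLt a b p) s ((T + 2) * m + 2) fun s' => I s' ∧ ¬ s'.var a < s'.var b := by
  intro P c h1 h2
  have h0 := h1
  simp only [Cmd.code, placed_cons, placed_append, Cmd.length_code] at h1
  obtain ⟨h3, h4, h5, h6, -⟩ := h1
  have h7 : (Instr.jumpLt (2 * a) (2 * b) (c.pc + 2)).exec c =
      ⟨if s.var a < s.var b then c.pc + 2 else c.pc + 1, c.reg, c.mem⟩ := by
    simp only [Instr.exec, h2.var]
  by_cases hc : s.var a < s.var b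
  · rw [if_pos hc] at h7
    have h8 := Trace.single h2.bdd h3 (by rw [h7]; exact h2.setPc.bdd)
    rw [h7] at h8
    obtain ⟨k, hk, c', s', h9, h10, h11, h12, h13⟩ := h s hI hc P _ h5
      (h2.setPc (pc := c.pc + 2))
    simp only at h10
    have h14 := Trace.single h11.bdd (ins := .jump c.pc)
      (by rw [h10]; rwa [show c.pc + 1 + 1 + p.size = c.pc + 2 + p.size by omega] at h6)
      h11.setPc.bdd
    -- The measure has dropped strictly below `μ s ≤ m`, so `m` is positive and one unit of it pays
    -- for this round: the body and two jumps.
    obtain ⟨m, rfl⟩ : ∃ m', m = m' + 1 := ⟨m - 1, by omega⟩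
    obtain ⟨l, hl, c'', s'', h15, h16, h17, h18⟩ :=
      Runs.whileLt h m s' (by omega) h12 P ⟨c.pc, c'.reg, c'.mem⟩ h0 h11.setPc
    refine ⟨1 + k + 1 + l, ?_, c'', s'', ((h8.trans h9).trans h14).trans h15, h16, h17, h18⟩
    rw [Nat.mul_succ]
    omega
  · rw [if_neg hc] at h7
    have h8 := Trace.single h2.bdd h3 (by rw [h7]; exact h2.setPc.bdd)
    rw [h7] at h8
    have h9 := Trace.single (P := P) (ins := .jump (c.pc + p.size + 3))
      (c := ⟨c.pc + 1, c.reg, c.mem⟩) h2.setPc.bdd h4 h2.setPc.bdd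
    exact ⟨1 + 1, by omega, _, s, h8.trans h9, by simp only [Instr.exec, Cmd.size]; omega,
      h2.setPc, hI, hc⟩
termination_by m

/-- Weakest preconditions of loop-free commands. -/
def wp (N W : ℕ) : Cmd → (Store → Prop) → Store → Prop
  | .nop, Q, s => Q s
  | .set d x, Q, s => x ≤ W ∧ Q (s.setVar d x)
  | .add d a b, Q, s => s.var a + s.var b ≤ W ∧ Q (s.setVar d (s.var a + s.var b))
  | .sub d a b, Q, s => Q (s.setVar d (s.var a - s.var b))
  | .rd d k a, Q, s => (k + 1) * N ≤ W ∧ s.var a < N ∧ Q (s.setVar d (s.arr k (s.var a)))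
  | .wr k a b, Q, s => (k + 1) * N ≤ W ∧ s.var a < N ∧ Q (s.setArr k (s.var a) (s.var b))
  | .seq p q, Q, s => wp N W p (wp N W q Q) s
  | .ifLt a b p q, Q, s => (s.var a < s.var b → wp N W p Q s) ∧
      (¬ s.var a < s.var b → wp N W q Q s)
  | .ifEq a b p q, Q, s => (s.var a = s.var b → wp N W p Q s) ∧
      (¬ s.var a = s.var b → wp N W q Q s)
  | .whileLt _ _ _, _, _ => False

/-- Without loops each instruction is executed at most once, so the size bounds the time. What
remains of a loop body is a symbolic evaluation. -/
theorem wp.runs {p : Cmd} {Q : Store → Prop} {s : Store} (h : wp N W p Q s) :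
    Runs N W p s p.size Q := by
  induction p generalizing Q s with
  | nop => exact Runs.nop h
  | set d x => exact Runs.set h.1 h.2
  | add d a b => exact Runs.add h.1 h.2
  | sub d a b => exact Runs.sub h
  | rd d k a => exact Runs.rd h.1 h.2.1 h.2.2
  | wr k a b => exact Runs.wr h.1 h.2.1 h.2.2
  | seq p q ihp ihq => exact (ihp h).seq fun s' h' => ihq h'
  | ifLt a b p q ihp ihq =>
    exact Runs.ifLt (fun hc => (ihp (h.1 hc)).mono (Nat.le_add_right _ _) fun _ h => h)
      (fun hc => (ihq (h.2 hc)).mono (Nat.le_add_left _ _) fun _ h => h)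
  | ifEq a b p q ihp ihq =>
    exact Runs.ifEq (fun hc => (ihp (h.1 hc)).mono (Nat.le_add_right _ _) fun _ h => h)
      (fun hc => (ihq (h.2 hc)).mono (Nat.le_add_left _ _) fun _ h => h)
  | whileLt a b p => exact h.elim

theorem Runs.whileLt_of_wp {p : Cmd} {a b : ℕ} {I : Store → Prop} (μ : Store → ℕ)
    (h : ∀ s, I s → s.var a < s.var b → wp N W p (fun s' => I s' ∧ μ s' < μ s) s)
    {m : ℕ} {s : Store} (hm : μ s ≤ m) (hI : I s) :
    Runs N W (.whileLt a b p) s ((p.size + 2) * m + 2)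
      fun s' => I s' ∧ ¬ s'.var a < s'.var b :=
  Runs.whileLt (fun s h1 h2 => (h s h1 h2).runs) m s hm hI

/-- A program that reads `n` from cell `0`, sets up arrays of length `2 * n + 2` and continues
with the command `p`. -/
def program (p : Cmd) : Program :=
  [.const 1 0, .load 0 1, .const 1 2, .add 3 0 0, .add 3 3 1] ++ p.code 5

/-- The store in which variable `0` holds `n` and array `0` holds the input. -/
def initialStore (n : ℕ) (input : List ℕ) : Store :=
  ⟨fun v => if v = 0 then n else 0, fun k i => if k = 0 then input.getD i 0 else 0⟩

/-- Array `0` begins at address `0`, so input and output both live in it. The five initial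
instructions provide `n` and the array length; what they leave in register `1` is scratch. -/
theorem runsTo_program {p : Cmd} {n T : ℕ} {input output : List ℕ} {Q : Store → Prop}
    (hn : input.getD 0 0 = n) (hlen : input.length ≤ 2 * n + 2) (hW : 2 * n + 2 ≤ W)
    (hin : ∀ x ∈ input, x ≤ W) (hout : output.length ≤ 2 * n + 2)
    (h : Runs (2 * n + 2) W p (initialStore n input) T Q)
    (hQ : ∀ s, Q s → ∀ i (hi : i < output.length), s.arr 0 i = output[i]) :
    RunsTo (program p) input output (T + 5) W := by
  have hmem : ∀ i, input.getD i 0 ≤ W := by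
    intro i
    rcases lt_or_ge i input.length with h1 | h1
    · rw [List.getD_eq_getElem _ _ h1]
      exact hin _ (List.getElem_mem h1)
    · rw [List.getD_eq_default _ _ h1]
      exact Nat.zero_le _
  set P := program p with hP
  have hpl : Placed P 0 ([.const 1 0, .load 0 1, .const 1 2, .add 3 0 0, .add 3 3 1] ++ p.code 5) :=
    fun i x hx => by rw [Nat.zero_add]; exact hx
  rw [placed_append] at hpl
  obtain ⟨hpl, hcode⟩ := hpl
  simp only [placed_cons] at hpl
  obtain ⟨i0, i1, i2, i3, i4, -⟩ := hpl
  have b0 : Bounded W (initial input) := fun i => ⟨Nat.zero_le _, hmem i⟩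
  have b1 := b0.update_reg (pc := 1) (d := 1) (x := 0) (Nat.zero_le _)
  have t1 := Trace.single b0 i0 b1
  have b2 := b1.update_reg (pc := 2) (d := 0) (x := input.getD 0 0) (hmem 0)
  have t2 := t1.trans (Trace.single b1 i1 b2)
  have b3 := b2.update_reg (pc := 3) (d := 1) (x := 2) (by omega)
  have t3 := t2.trans (Trace.single b2 i2 b3)
  have b4 := b3.update_reg (pc := 4) (d := 3) (x := input.getD 0 0 + input.getD 0 0) (by omega)
  have t4 := t3.trans (Trace.single b3 i3 b4)
  have b5 := b4.update_reg (pc := 5) (d := 3) (x := input.getD 0 0 + input.getD 0 0 + 2)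
    (by omega)
  have t5 := t4.trans (Trace.single b4 i4 b5)
  obtain ⟨k, hk, c', s', h3, h4, h5, h6⟩ := h P _ hcode
    (by
      refine ⟨fun v => ?_, ?_, fun k i hi => ?_, b5⟩
      · simp only [Function.update_apply, initialStore, initial]
        rcases v with _ | v
        · simpa using hn
        · rw [if_neg (by omega), if_neg (by omega), if_neg (by omega), if_neg (by omega),
            if_neg (by omega), if_neg (by omega)]
      · simp only [Function.update_self, hn]; omega
      · simp only [initialStore, initial]
        rcases k with _ | k
        · simp
        -- The input fits into array `0`, so all other arrays start as zero.
        · rw [if_neg (by omega), List.getD_eq_default]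
          rw [Nat.succ_mul]
          omega)
  have t6 := t5.trans h3
  refine ⟨_, ?_, ?_, ?_, t6.2⟩
  · omega
  · rw [t6.1, Halted, h4, hP, program, List.length_append, Cmd.length_code]
    rfl
  · intro i hi
    rw [t6.1, ← hQ s' h6 i hi, ← h5.arr 0 i (by omega), Nat.zero_mul, Nat.zero_add]

/-! ### Iteration of a map -/

/-- Iteration of `g` leads from `u` to `w`. -/
def Reach (g : ℕ → ℕ) (u w : ℕ) : Prop := ∃ k, g^[k] u = w

/-- `u` is a periodic point of `g`. -/
def Per (g : ℕ → ℕ) (u : ℕ) : Prop := Reach g (g u) u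

section Reach

variable {g g' : ℕ → ℕ} {u v w : ℕ}

theorem Reach.refl (g : ℕ → ℕ) (u : ℕ) : Reach g u u := ⟨0, rfl⟩

theorem Reach.trans (h : Reach g u v) (h' : Reach g v w) : Reach g u w := by
  obtain ⟨k, rfl⟩ := h
  obtain ⟨l, rfl⟩ := h'
  exact ⟨l + k, Function.iterate_add_apply _ _ _ _⟩

theorem Reach.step (g : ℕ → ℕ) (u : ℕ) : Reach g u (g u) := ⟨1, rfl⟩

theorem Reach.head (h : Reach g (g u) w) : Reach g u w := (Reach.step g u).trans h

theorem Reach.tail (h : Reach g u w) : Reach g u (g w) := h.trans (Reach.step g w)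

theorem Reach.eq_or_head (h : Reach g u w) : u = w ∨ Reach g (g u) w := by
  obtain ⟨k, rfl⟩ := h
  cases k with
  | zero => exact Or.inl rfl
  | succ k => exact Or.inr ⟨k, rfl⟩

theorem Reach.induct {S : ℕ → Prop} (h : Reach g u w) (h0 : S u)
    (hS : ∀ x, S x → S (g x)) : S w := by
  obtain ⟨k, rfl⟩ := h
  induction k with
  | zero => exact h0
  | succ k ih => rw [Function.iterate_succ_apply']; exact hS _ ih

theorem Reach.linear (h : Reach g u v) (h' : Reach g u w) : Reach g v w ∨ Reach g w v := by
  obtain ⟨k, rfl⟩ := h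
  obtain ⟨l, rfl⟩ := h'
  rcases le_total k l with h | h
  · obtain ⟨d, rfl⟩ := Nat.exists_eq_add_of_le' h
    exact Or.inl ⟨d, (Function.iterate_add_apply _ _ _ _).symm⟩
  · obtain ⟨d, rfl⟩ := Nat.exists_eq_add_of_le' h
    exact Or.inr ⟨d, (Function.iterate_add_apply _ _ _ _).symm⟩

theorem iterate_congr (h : ∀ x, Reach g u x → g' x = g x) (k : ℕ) : g'^[k] u = g^[k] u := by
  induction k with
  | zero => rfl
  | succ k ih =>
    rw [Function.iterate_succ_apply', Function.iterate_succ_apply', ih]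
    exact h _ ⟨k, rfl⟩

theorem reach_congr (h : ∀ x, Reach g u x → g' x = g x) : Reach g' u w ↔ Reach g u w := by
  simp only [Reach, iterate_congr h]

theorem per_congr (h : ∀ x, Reach g u x → g' x = g x) : Per g' u ↔ Per g u := by
  rw [Per, Per, h u (Reach.refl g u)]
  exact reach_congr fun x hx => h x hx.head

/-- The value at `w` is irrelevant, since the path is followed only to its first arrival there. This
carries paths across redirections at their endpoints. -/
theorem Reach.congr_until (h : Reach g u w)
    (h' : ∀ x, Reach g u x → Reach g x w → x ≠ w → g' x = g x) : Reach g' u w := by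
  obtain ⟨k, hk⟩ := h
  induction k generalizing u with
  | zero => exact ⟨0, hk⟩
  | succ k ih =>
    by_cases hu : u = w
    · exact ⟨0, hu⟩
    · apply Reach.head
      rw [h' u (Reach.refl g u) ⟨k + 1, hk⟩ hu]
      exact ih (fun x hx => h' x hx.head) hk

/-- The points that lead to `u` are closed under `g`: a step can leave this set only at `u`, and `u`
returns to itself. -/
theorem Per.reach_symm (h : Per g u) (h' : Reach g u w) : Reach g w u := by
  refine h'.induct (S := fun w => Reach g w u) (Reach.refl g u) fun x hx => ?_
  rcases hx.eq_or_head with rfl | hx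
  · exact h
  · exact hx

theorem Per.of_reach (h : Per g u) (h' : Reach g u w) : Per g w :=
  (h.reach_symm h'.tail).trans h'

end Reach

/-! ### Maps that represent digraphs -/

/-- `g` maps `2, …, n` into `1, …, n` and is zero elsewhere. -/
structure IsMap (n : ℕ) (g : ℕ → ℕ) : Prop where
  zero : g 0 = 0
  one : g 1 = 0
  pos : ∀ v, 2 ≤ v → v ≤ n → 1 ≤ g v
  le : ∀ v, g v ≤ n
  big : ∀ v, n < v → g v = 0

section IsMap

variable {n : ℕ} {g g' : ℕ → ℕ} {u v w p m x : ℕ}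

theorem IsMap.reach_zero (h : IsMap n g) (h' : Reach g 0 w) : w = 0 :=
  h'.induct (S := fun w => w = 0) rfl fun x hx => by rw [hx, h.zero]

theorem IsMap.reach_one (h : IsMap n g) (h' : Reach g 1 w) : w = 1 ∨ w = 0 := by
  rcases h'.eq_or_head with h1 | h1
  · exact Or.inl h1.symm
  · rw [h.one] at h1
    exact Or.inr (h.reach_zero h1)

theorem IsMap.reach_le (h : IsMap n g) (h' : Reach g u w) (hu : u ≤ n) : w ≤ n :=
  h'.induct (S := fun w => w ≤ n) hu fun _ _ => h.le _

/-- The orbit of `1` is absorbed by the fixed point `0`, so a cycle through any other vertex avoids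
both. The loop at `0` is the reason why `u ≠ 0` accompanies `Per` throughout. -/
theorem IsMap.per_inner (h : IsMap n g) (hu : Per g u) (h0 : u ≠ 0) :
    2 ≤ u ∧ u ≤ n ∧ g u ≠ 0 ∧ g u ≠ 1 := by
  have h1 : g u ≠ 0 := fun h1 => h0 (h.reach_zero (h1 ▸ hu))
  have h2 : u ≠ 1 := by rintro rfl; exact h1 h.one
  have h3 : u ≤ n := by by_contra h3; exact h1 (h.big u (by omega))
  refine ⟨by omega, h3, h1, fun h4 => ?_⟩
  rw [Per, h4] at hu
  rcases h.reach_one hu with h5 | h5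
  · exact h2 h5
  · exact h0 h5

theorem IsMap.per_reach_ne_zero (h : IsMap n g) (hu : Per g u) (h0 : u ≠ 0) (hx : Reach g u x) :
    x ≠ 0 := by
  rintro rfl
  exact h0 (h.reach_zero (hu.reach_symm hx))

/-- `n` leads to `p` and from there to `1`, and `p` is larger than all vertices on cycles. -/
structure Good (n : ℕ) (g : ℕ → ℕ) (p : ℕ) : Prop where
  map : IsMap n g
  two_le : 2 ≤ p
  eq_one : g p = 1
  reach : Reach g n p
  lt : ∀ u, u ≠ 0 → Per g u → u < p

/-- `(g', m)` results from `(g, p)` by inserting the cycle with the largest vertex `m` between `p`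
and `1`. -/
structure Splice (g : ℕ → ℕ) (p : ℕ) (g' : ℕ → ℕ) (m : ℕ) : Prop where
  per : Per g m
  ne_zero : m ≠ 0
  max : ∀ u, u ≠ 0 → Per g u → u ≤ m
  eq : g' = Function.update (Function.update g p (g m)) m 1

/-! ### Splicing in a single cycle, and undoing it -/

theorem Good.le (h : Good n g p) : p ≤ n := h.map.reach_le h.reach le_rfl

theorem Splice.apply_self (h : Splice g p g' m) : g' m = 1 := by
  rw [h.eq, Function.update_self]

theorem Splice.apply_of_ne (h : Splice g p g' m) (hp : x ≠ p) (hm : x ≠ m) : g' x = g x := by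
  rw [h.eq, Function.update_of_ne hm, Function.update_of_ne hp]

theorem Splice.lt (hg : Good n g p) (h : Splice g p g' m) : m < p := hg.lt m h.ne_zero h.per

theorem Splice.apply_prev (hg : Good n g p) (h : Splice g p g' m) : g' p = g m := by
  rw [h.eq, Function.update_of_ne (h.lt hg).ne', Function.update_self]

theorem Splice.two_le (hg : Good n g p) (h : Splice g p g' m) : 2 ≤ m :=
  (hg.map.per_inner h.per h.ne_zero).1

theorem Splice.isMap (hg : Good n g p) (h : Splice g p g' m) : IsMap n g' := by
  have h1 := h.lt hg
  have h2 := h.two_le hg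
  have h3 := hg.le
  have h4 := hg.map.per_inner h.per h.ne_zero
  refine ⟨?_, ?_, fun v hv hv' => ?_, fun v => ?_, fun v hv => ?_⟩
  · rw [h.apply_of_ne (by omega) (by omega), hg.map.zero]
  · rw [h.apply_of_ne (by omega) (by omega), hg.map.one]
  · simp only [h.eq, Function.update_apply]
    split_ifs
    · exact le_rfl
    · omega
    · exact hg.map.pos v hv hv'
  · simp only [h.eq, Function.update_apply]
    split_ifs
    · omega
    · exact hg.map.le _
    · exact hg.map.le _
  · rw [h.apply_of_ne (by omega) (by omega), hg.map.big v hv]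

/-- Vertices on cycles are smaller than `p`, so the way round from `g m` to `m` meets neither
redirected vertex before its end. -/
theorem Splice.reach_cycle (hg : Good n g p) (h : Splice g p g' m) : Reach g' (g m) m := by
  refine Reach.congr_until h.per fun x hx _ hxm => h.apply_of_ne ?_ hxm
  exact (hg.lt x (hg.map.per_reach_ne_zero h.per h.ne_zero hx.head)
    (h.per.of_reach hx.head)).ne

theorem Splice.agree (hg : Good n g p) (h : Splice g p g' m) (hu : Per g u) (hm : ¬ Reach g m u) :
    ∀ x, Reach g u x → g' x = g x := by
  intro x hx
  by_cases h0 : u = 0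
  · subst h0
    have := h.two_le hg
    have := h.lt hg
    exact h.apply_of_ne (by rw [hg.map.reach_zero hx]; omega)
      (by rw [hg.map.reach_zero hx]; omega)
  · refine h.apply_of_ne (hg.lt x (hg.map.per_reach_ne_zero hu h0 hx) (hu.of_reach hx)).ne ?_
    rintro rfl
    exact hm (hu.reach_symm hx)

/-- A cycle of `g'` avoids `m`, which is sent to `1`, and therefore `p`, which leads on to `m`. On
such a cycle the two maps agree. -/
theorem Splice.per_of_per (hg : Good n g p) (h : Splice g p g' m) (hu : Per g' u) :
    Per g u ∧ ¬ Reach g m u := by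
  have hmap := h.isMap hg
  have h1 : ¬ Reach g' u m := fun h1 =>
    (hmap.per_inner (hu.of_reach h1) h.ne_zero).2.2.2 h.apply_self
  have h2 : ¬ Reach g' u p := fun h2 => by
    have h3 := h2.tail
    rw [h.apply_prev hg] at h3
    exact h1 (h3.trans (h.reach_cycle hg))
  have h3 : ∀ x, Reach g' u x → g x = g' x := fun x hx =>
    (h.apply_of_ne (by rintro rfl; exact h2 hx) (by rintro rfl; exact h1 hx)).symm
  have h4 : Per g u := (per_congr h3).2 hu
  exact ⟨h4, fun h5 => h1 ((reach_congr h3).1 (h.per.reach_symm h5))⟩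

theorem Splice.per_iff (hg : Good n g p) (h : Splice g p g' m) :
    Per g' u ↔ Per g u ∧ ¬ Reach g m u :=
  ⟨fun hu => h.per_of_per hg hu, fun hu => (per_congr (h.agree hg hu.1 hu.2)).2 hu.1⟩

theorem Splice.reach_prev (hg : Good n g p) (h : Splice g p g' m) : Reach g' n p := by
  refine hg.reach.congr_until fun x hx hxp hne => h.apply_of_ne hne ?_
  rintro rfl
  exact (hg.lt p (by have := hg.two_le; omega) (h.per.of_reach hxp)).ne rfl

theorem Splice.good (hg : Good n g p) (h : Splice g p g' m) : Good n g' m := by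
  refine ⟨h.isMap hg, h.two_le hg, h.apply_self, ?_, fun u h0 hu => ?_⟩
  · have h2 := (h.reach_prev hg).tail
    rw [h.apply_prev hg] at h2
    exact h2.trans (h.reach_cycle hg)
  · obtain ⟨h1, h2⟩ := h.per_of_per hg hu
    refine lt_of_le_of_ne (h.max u h0 h1) ?_
    rintro rfl
    exact h2 (Reach.refl g u)

/-- The vertices between `p` and `m` on the path after splicing lie on cycles and are at most
`m`. -/
theorem Splice.le_of_reach (hg : Good n g p) (h : Splice g p g' m) (hx : Reach g' (g' p) x) :
    x ≤ m ∧ (Per g x ∨ x ≤ 1) := by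
  have h2 := h.two_le hg
  rw [h.apply_prev hg] at hx
  have h3 : ∀ y, Per g y → Per g (g y) ∧ g y ≤ m := fun y hy => by
    refine ⟨hy.of_reach (Reach.step g y), ?_⟩
    by_cases h0 : g y = 0
    · omega
    · exact h.max _ h0 (hy.of_reach (Reach.step g y))
  -- Along the orbit one is either still among the old periodic points, bounded by the maximality of
  -- `m`, or has left through `m` and is at `1` or `0`.
  refine hx.induct (S := fun x => x ≤ m ∧ (Per g x ∨ x ≤ 1))
    ⟨(h3 m h.per).2, Or.inl (h3 m h.per).1⟩ fun y hy => ?_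
  by_cases hym : y = m
  · rw [hym, h.apply_self]
    exact ⟨by omega, Or.inr le_rfl⟩
  · rw [h.apply_of_ne (by have := h.lt hg; omega) hym]
    rcases hy.2 with hy2 | hy2
    · exact ⟨(h3 y hy2).2, Or.inl (h3 y hy2).1⟩
    · have h4 : g y = 0 := by
        interval_cases y
        · exact hg.map.zero
        · exact hg.map.one
      rw [h4]
      exact ⟨by omega, Or.inr (by omega)⟩

/-- Both `p₁` and `p₂` lie on the orbit of `n` and exceed `m`. If they differed, one would come
after the other and be at most `m` by `Splice.le_of_reach`. Once `p` is known, the redirections can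
be reverted. -/
theorem Splice.left_unique {g₁ g₂ : ℕ → ℕ} {p₁ p₂ : ℕ} (hg₁ : Good n g₁ p₁)
    (hg₂ : Good n g₂ p₂) (h₁ : Splice g₁ p₁ g m) (h₂ : Splice g₂ p₂ g m) :
    g₁ = g₂ ∧ p₁ = p₂ := by
  have hp : p₁ = p₂ := by
    by_contra hne
    rcases (h₁.reach_prev hg₁).linear (h₂.reach_prev hg₂) with h | h
    · have h3 := h₁.le_of_reach hg₁ (h.eq_or_head.resolve_left hne)
      have h3 := h3.1
      have := h₂.lt hg₂
      omega
    · have h3 := h₂.le_of_reach hg₂ (h.eq_or_head.resolve_left (Ne.symm hne))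
      have h3 := h3.1
      have := h₁.lt hg₁
      omega
  subst hp
  refine ⟨funext fun x => ?_, rfl⟩
  by_cases hxp : x = p₁
  · rw [hxp, hg₁.eq_one, hg₂.eq_one]
  · by_cases hxm : x = m
    · rw [hxm, ← h₁.apply_prev hg₁, ← h₂.apply_prev hg₂]
    · rw [← h₁.apply_of_ne hxp hxm, ← h₂.apply_of_ne hxp hxm]

/-- The inverse of splicing: cut a cycle off the path that leads from `n` to `p`. -/
theorem Good.cut (hg : Good n g p) (hx : Reach g n x) (hpx : p < x)
    (hxp : Reach g (g x) p) (hle : ∀ z, Reach g (g x) z → Reach g z p → z ≤ p) :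
    Good n (Function.update (Function.update g p (g x)) x 1) x ∧
      Splice (Function.update (Function.update g p (g x)) x 1) x g p := by
  set g' := Function.update (Function.update g p (g x)) x 1 with hg'
  have hp2 := hg.two_le
  have hpn := hg.le
  have hxn := hg.map.reach_le hx le_rfl
  have e1 : g' x = 1 := Function.update_self _ _ _
  have e2 : g' p = g x := by rw [hg', Function.update_of_ne hpx.ne, Function.update_self]
  have e3 : ∀ y, y ≠ p → y ≠ x → g' y = g y := fun y hy hy' => by
    rw [hg', Function.update_of_ne hy', Function.update_of_ne hy]
  have hmap : IsMap n g' := by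
    refine ⟨?_, ?_, fun v hv hv' => ?_, fun v => ?_, fun v hv => ?_⟩
    · rw [e3 _ (by omega) (by omega), hg.map.zero]
    · rw [e3 _ (by omega) (by omega), hg.map.one]
    · simp only [hg', Function.update_apply]
      split_ifs
      · exact le_rfl
      · exact hg.map.pos x (by omega) hxn
      · exact hg.map.pos v hv hv'
    · simp only [hg', Function.update_apply]
      split_ifs
      · omega
      · exact hg.map.le _
      · exact hg.map.le _
    · rw [e3 _ (by omega) (by omega), hg.map.big v hv]
  have hper : Per g' p := by
    rw [Per, e2]
    -- The segment from `g x` to `p` is bounded by `p < x`, so it does not meet `x`.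
    refine hxp.congr_until fun z hz hzp hne => e3 z hne ?_
    have := hle z hz hzp
    omega
  have hcyc : ∀ u, Reach g' p u → u ≤ p := by
    intro u hu
    -- The new orbit of `p` stays on the old segment from `g x` to `p`: at `p` it wraps around to `g
    -- x`.
    suffices Reach g (g x) u ∧ Reach g u p from hle u this.1 this.2
    refine hu.induct (S := fun u => Reach g (g x) u ∧ Reach g u p)
      ⟨hxp, Reach.refl g p⟩ fun y hy => ?_
    by_cases hyp : y = p
    · rw [hyp, e2]
      exact ⟨Reach.refl _ _, hxp⟩
    · rw [e3 y hyp (by have := hle y hy.1 hy.2; omega)]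
      exact ⟨hy.1.tail, hy.2.eq_or_head.resolve_left hyp⟩
  have hmax : ∀ u, u ≠ 0 → Per g' u → u ≤ p := by
    intro u h0 hu
    -- A cycle that avoids `p` also avoids `x`, which is sent to `1`; hence it is a cycle of `g`,
    -- and its vertices are below `p`.
    by_cases hup : Reach g' u p
    · exact hcyc u (hu.reach_symm hup)
    · have h1 : ∀ z, Reach g' u z → g z = g' z := fun z hz => by
        refine (e3 z (by rintro rfl; exact hup hz) ?_).symm
        rintro rfl
        exact (hmap.per_inner (hu.of_reach hz) (by omega)).2.2.2 e1
      exact (hg.lt u h0 ((per_congr h1).2 hu)).le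
  refine ⟨⟨hmap, by omega, e1, ?_, fun u h0 hu => (hmax u h0 hu).trans_lt hpx⟩,
    ⟨hper, by omega, hmax, ?_⟩⟩
  -- The path from `n` to `x` cannot pass through `p`, after which only `1` and `0` follow.
  · refine hx.congr_until fun z _ hzx hne => e3 z ?_ hne
    rintro rfl
    rcases hzx.eq_or_head with h1 | h1
    · exact hne h1
    · rw [hg.eq_one] at h1
      have := hg.map.reach_one h1
      omega
  · funext y
    by_cases hyp : y = p
    · rw [hyp, Function.update_self, hg.eq_one]
    · rw [Function.update_of_ne hyp]
      by_cases hyx : y = x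
      · rw [hyx, Function.update_self, e2]
      · rw [Function.update_of_ne hyx, e3 y hyp hyx]

end IsMap

/-! ### Sequences of splicings -/

/-- One splicing, as a relation between pairs. -/
def SpliceRel (n : ℕ) (s s' : (ℕ → ℕ) × ℕ) : Prop := Good n s.1 s.2 ∧ Splice s.1 s.2 s'.1 s'.2

/-- A sequence of splicings. -/
def Chain (n : ℕ) : (ℕ → ℕ) × ℕ → (ℕ → ℕ) × ℕ → Prop := Relation.ReflTransGen (SpliceRel n)

theorem Chain.good {n : ℕ} {s s' : (ℕ → ℕ) × ℕ} (h : Chain n s s') (hs : Good n s.1 s.2) :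
    Good n s'.1 s'.2 := by
  induction h with
  | refl => exact hs
  | tail _ h _ => exact h.2.good h.1

theorem Chain.le {n : ℕ} {s s' : (ℕ → ℕ) × ℕ} (h : Chain n s s') : s'.2 ≤ s.2 := by
  induction h with
  | refl => exact le_rfl
  | tail _ h ih => exact (h.2.lt h.1).le.trans ih

theorem Chain.eq_of_eq {n : ℕ} {s s' : (ℕ → ℕ) × ℕ} (h : Chain n s s') (he : s'.2 = s.2) :
    s = s' := by
  induction h with
  | refl => rfl
  | tail h' h _ =>
    have h1 := Chain.le h'
    have h2 := h.2.lt h.1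
    omega

/-- Two sequences of splicings that start with the vertex `n` and have the same end are equal. -/
theorem Chain.start_unique {n : ℕ} {g₁ g₂ : ℕ → ℕ} {s : (ℕ → ℕ) × ℕ} (h₁ : Chain n (g₁, n) s)
    (h₂ : Chain n (g₂, n) s) : g₁ = g₂ := by
  have hu : Relator.RightUnique (Function.swap (SpliceRel n)) := by
    rintro a b c ⟨h1, h2⟩ ⟨h3, h4⟩
    obtain ⟨h5, h6⟩ := Splice.left_unique h1 h3 h2 h4
    exact Prod.ext h5 h6
  -- Read backwards, splicing is deterministic, so one start lies on the chain of the other. Both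
  -- have second component `n`, which every splicing strictly lowers, so the chain between them is
  -- empty.
  have h3 := Relation.ReflTransGen.total_of_right_unique hu
    (Relation.reflTransGen_swap.2 h₁) (Relation.reflTransGen_swap.2 h₂)
  rcases h3 with h3 | h3
  · exact (congrArg Prod.fst (Chain.eq_of_eq (Relation.reflTransGen_swap.1 h3) rfl)).symm
  · exact congrArg Prod.fst (Chain.eq_of_eq (Relation.reflTransGen_swap.1 h3) rfl)

/-! ### Functions and trees as maps -/

/-- No vertex lies on a cycle. -/
def Acyclic (g : ℕ → ℕ) : Prop := ∀ u, u ≠ 0 → ¬ Per g u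

/-- The map that agrees with `f` on `2, …, n - 1` and sends `n` to `1`. -/
def extend {n : ℕ} (f : FunClass n) (v : ℕ) : ℕ :=
  if h : 2 ≤ v ∧ v < n then (f ⟨v, h⟩).1 else if v = n then 1 else 0

/-- The digraph with the edges `⟨v, g v⟩`. -/
def digraphOf (n : ℕ) (g : ℕ → ℕ) : Digraph (Vertex n) where
  Adj v w := g v.1 = w.1

section

variable {n : ℕ} {g g' g₀ : ℕ → ℕ} {p m : ℕ}

theorem extend_inner (f : FunClass n) {v : ℕ} (h : 2 ≤ v ∧ v < n) :
    extend f v = (f ⟨v, h⟩).1 := dif_pos h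

theorem extend_self (f : FunClass n) : extend f n = 1 := by simp [extend]

theorem extend_isMap (hn : 2 ≤ n) (f : FunClass n) : IsMap n (extend f) := by
  refine ⟨?_, ?_, fun v hv hv' => ?_, fun v => ?_, fun v hv => ?_⟩
  · simp only [extend]; rw [dif_neg (by omega), if_neg (by omega)]
  · simp only [extend]; rw [dif_neg (by omega), if_neg (by omega)]
  · rcases hv'.lt_or_eq with h | rfl
    · rw [extend_inner f ⟨hv, h⟩]; exact (f _).2.1
    · rw [extend_self]
  · simp only [extend]
    split_ifs with h
    · exact (f _).2.2
    · omega
    · omega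
  · simp only [extend]; rw [dif_neg (by omega), if_neg (by omega)]

theorem exists_extend_eq (h : IsMap n g) (h1 : g n = 1) : ∃ f : FunClass n, extend f = g := by
  refine ⟨fun i => ⟨g i.1, h.pos _ i.2.1 i.2.2.le, h.le _⟩, funext fun v => ?_⟩
  simp only [extend]
  split_ifs with h2 h3
  · rfl
  · rw [h3, h1]
  · have h4 := h.zero
    have h5 := h.one
    rcases lt_or_ge n v with h6 | h6
    · rw [h.big v h6]
    · obtain rfl | rfl : v = 0 ∨ v = 1 := by omega
      · exact h4.symm
      · exact h5.symm

theorem extend_injective : Function.Injective (extend (n := n)) := by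
  intro f f' h
  funext i
  have := congrFun h i.1
  rwa [extend_inner f i.2, extend_inner f' i.2, ← Subtype.ext_iff] at this

theorem extend_good (hn : 2 ≤ n) (f : FunClass n) : Good n (extend f) n := by
  refine ⟨extend_isMap hn f, hn, extend_self f, Reach.refl _ _, fun u h0 hu => ?_⟩
  have h := (extend_isMap hn f).per_inner hu h0
  refine lt_of_le_of_ne h.2.1 ?_
  rintro rfl
  exact h.2.2.2 (extend_self f)

/-! ### Cycles of `graph(f)` as periodic points -/

theorem graph_adj (f : FunClass n) (hn : 2 ≤ n) (v w : Vertex n) :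
    (graph f).Adj v w ↔ v.1 ≠ n ∧ extend f v.1 = w.1 := by
  constructor
  · rintro ⟨i, hi, rfl⟩
    rw [← hi, extend_inner f i.2]
    exact ⟨i.2.2.ne, rfl⟩
  · rintro ⟨h1, h2⟩
    have h3 := v.2
    have h4 := w.2
    have h5 : v.1 ≠ 1 := fun h5 => by
      rw [h5, (extend_isMap hn f).one] at h2
      omega
    have h6 : 2 ≤ v.1 ∧ v.1 < n := by omega
    exact ⟨⟨v.1, h6⟩, rfl, Subtype.ext (by rw [← h2, extend_inner f h6])⟩

/-- The edge `(n, 1)` added by `extend` does no harm: a periodic orbit never visits `n`, because `n`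
is sent to `1`. -/
theorem transGen_graph (f : FunClass n) (hn : 2 ≤ n) {v : Vertex n} (hv : Per (extend f) v.1)
    {x : ℕ} (hx : Reach (extend f) (extend f v.1) x) :
    ∃ h : 1 ≤ x ∧ x ≤ n, Relation.TransGen (graph f).Adj v ⟨x, h⟩ := by
  have hmap := extend_isMap hn f
  have hstep : ∀ y, y ≠ 0 → Per (extend f) y → y ≠ n ∧ 1 ≤ extend f y ∧ extend f y ≤ n := by
    intro y h0 hy
    have h1 := hmap.per_inner hy h0
    refine ⟨?_, by omega, hmap.le _⟩
    rintro rfl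
    exact h1.2.2.2 (extend_self f)
  refine hx.induct (S := fun x => ∃ h : 1 ≤ x ∧ x ≤ n, Relation.TransGen (graph f).Adj v ⟨x, h⟩)
    ?_ ?_
  · obtain ⟨h1, h2⟩ := hstep v.1 (by have := v.2.1; omega) hv
    exact ⟨h2, .single ((graph_adj f hn _ _).2 ⟨h1, rfl⟩)⟩
  · rintro y ⟨hy, h⟩
    have hper : Per (extend f) y := by
      refine hv.of_reach ?_
      clear hx
      generalize hz : (⟨y, hy⟩ : Vertex n) = z at h
      obtain rfl : y = z.1 := by rw [← hz]
      clear hz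
      induction h with
      | single h => rw [← ((graph_adj f hn _ _).1 h).2]; exact Reach.step _ _
      | tail _ h ih =>
        rw [← ((graph_adj f hn _ _).1 h).2]
        exact (ih (by rename_i b _ _; exact b.2)).tail
    obtain ⟨h1, h2⟩ := hstep y (by omega) hper
    exact ⟨h2, h.tail ((graph_adj f hn _ _).2 ⟨h1, rfl⟩)⟩

theorem reach_of_transGen (f : FunClass n) (hn : 2 ≤ n) {v w : Vertex n}
    (h : Relation.TransGen (graph f).Adj v w) : Reach (extend f) (extend f v.1) w.1 := by
  induction h with
  | single h => rw [← ((graph_adj f hn _ _).1 h).2]; exact Reach.refl _ _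
  | tail _ h ih => rw [← ((graph_adj f hn _ _).1 h).2]; exact ih.tail

theorem sameCycle_iff (f : FunClass n) (hn : 2 ≤ n) (v w : Vertex n) :
    SameCycle f v w ↔ Per (extend f) v.1 ∧ Reach (extend f) v.1 w.1 := by
  constructor
  · rintro ⟨h1, h2⟩
    have h3 := reach_of_transGen f hn h1
    exact ⟨h3.trans (reach_of_transGen f hn h2).head, h3.head⟩
  · rintro ⟨h1, h2⟩
    have h3 : Per (extend f) w.1 := h1.of_reach h2
    have h4 : Reach (extend f) (extend f v.1) w.1 := Reach.trans h1 h2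
    exact ⟨(transGen_graph f hn h1 h4).2,
      (transGen_graph f hn h3 (h3.trans (h1.reach_symm h2))).2⟩

/-- `r` is the largest vertex of a cycle of `g`. -/
def IsMax (g : ℕ → ℕ) (r : ℕ) : Prop := r ≠ 0 ∧ Per g r ∧ ∀ x, Reach g r x → x ≤ r

theorem isRightEnd_iff (f : FunClass n) (hn : 2 ≤ n) (r : Vertex n) :
    IsRightEnd f r ↔ IsMax (extend f) r.1 := by
  simp only [IsRightEnd, sameCycle_iff f hn]
  constructor
  · rintro ⟨⟨h1, -⟩, h2⟩
    have h0 : r.1 ≠ 0 := by have := r.2.1; omega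
    refine ⟨h0, h1, fun x hx => ?_⟩
    have hmap := extend_isMap hn f
    have h3 := hmap.per_reach_ne_zero h1 h0 hx
    exact h2 ⟨x, by omega, hmap.reach_le hx r.2.2⟩ ⟨h1, hx⟩
  · rintro ⟨-, h1, h2⟩
    exact ⟨⟨h1, Reach.refl _ _⟩, fun w hw => h2 _ hw.2⟩

theorem IsMax.inner (hmap : IsMap n g) {r : ℕ} (h : IsMax g r) : 2 ≤ r ∧ r ≤ n :=
  ⟨(hmap.per_inner h.2.1 h.1).1, (hmap.per_inner h.2.1 h.1).2.1⟩

theorem Splice.isMax (h : Splice g p g' m) (hmap : IsMap n g) : IsMax g m :=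
  ⟨h.ne_zero, h.per, fun x hx => h.max x (hmap.per_reach_ne_zero h.per h.ne_zero hx)
    (h.per.of_reach hx)⟩

/-- The relation between the map `g₀` and the result `g` of splicing in the cycles of `g₀` whose
maximum is at least `p`. -/
structure SplicedFrom (n : ℕ) (g₀ g : ℕ → ℕ) (p : ℕ) : Prop where
  orbit : ∀ u, u ≠ 0 → Per g u → ∀ x, Reach g u x → g₀ x = g x
  per : ∀ r, IsMax g₀ r → r < p → Per g r
  eq : ∀ v, ¬ IsMax g₀ v → v ≠ n → g v = g₀ v
  last : p = n ∨ IsMax g₀ p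
  next : ∀ v, p < v → (v = n ∨ IsMax g₀ v) → ∃ s, IsMax g₀ s ∧ s < v ∧
    (∀ r, IsMax g₀ r → ¬ (s < r ∧ r < v)) ∧ g v = g₀ s

theorem SplicedFrom.start (hg : Good n g n) : SplicedFrom n g g n := by
  refine ⟨fun _ _ _ _ _ => rfl, fun r hr _ => hr.2.1, fun _ _ _ => rfl, Or.inl rfl, ?_⟩
  rintro v hv (rfl | h)
  · omega
  · have := (h.inner hg.map).2
    omega

theorem SplicedFrom.isMax (h : SplicedFrom n g₀ g p) (hs : IsMax g m) : IsMax g₀ m := by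
  have h1 := h.orbit m hs.1 hs.2.1
  exact ⟨hs.1, (per_congr h1).2 hs.2.1, fun x hx => hs.2.2 x ((reach_congr h1).1 hx)⟩

/-- A maximum of `g₀` strictly between `m` and `p` would still be periodic under `g`, against the
choice of `m`; so `p` is linked to the cycle that comes next. Maxima below `m` belong to other
cycles and stay periodic. -/
theorem SplicedFrom.splice (h : SplicedFrom n g₀ g p) (hmap : IsMap n g₀) (hg : Good n g p)
    (hs : Splice g p g' m) : SplicedFrom n g₀ g' m := by
  have hm := h.isMax (hs.isMax hg.map)
  have hmp := hs.lt hg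
  refine ⟨fun u h0 hu x hx => ?_, fun r hr hrm => ?_, fun v hv hvn => ?_, Or.inr hm, ?_⟩
  · obtain ⟨h1, h2⟩ := hs.per_of_per hg hu
    have h3 := hs.agree hg h1 h2
    have h4 := (reach_congr h3).1 hx
    rw [h.orbit u h0 h1 x h4, h3 x h4]
  · refine (hs.per_iff hg).2 ⟨h.per r hr (by omega), fun h1 => ?_⟩
    have h2 : Reach g₀ m r := (reach_congr (h.orbit m hs.ne_zero hs.per)).2 h1
    have := hr.2.2 m (hm.2.1.reach_symm h2)
    omega
  · have h1 : v ≠ m := by rintro rfl; exact hv hm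
    have h2 : v ≠ p := by
      rintro rfl
      rcases h.last with h2 | h2
      · exact hvn h2
      · exact hv h2
    rw [hs.apply_of_ne h2 h1, h.eq v hv hvn]
  · intro v hmv hv
    have hno : ∀ r, IsMax g₀ r → ¬ (m < r ∧ r < p) := fun r hr hr' => by
      have := hs.max r hr.1 (h.per r hr hr'.2)
      omega
    rcases lt_trichotomy v p with h1 | rfl | h1
    · rcases hv with rfl | hv
      · have := hg.le
        omega
      · exact (hno v hv ⟨hmv, h1⟩).elim
    · refine ⟨m, hm, hmp, hno, ?_⟩
      rw [hs.apply_prev hg, h.orbit m hs.ne_zero hs.per m (Reach.refl _ _)]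
    · rw [hs.apply_of_ne (by omega) (by omega)]
      exact h.next v h1 hv

theorem Chain.splicedFrom {n : ℕ} {g₀ : ℕ → ℕ} {s : (ℕ → ℕ) × ℕ} (h : Chain n (g₀, n) s)
    (hg : Good n g₀ n) : SplicedFrom n g₀ s.1 s.2 := by
  induction h with
  | refl => exact .start hg
  | tail _ h ih => exact ih.splice hg.map h.1 h.2

/-- As `g` has no cycles, `SplicedFrom.per` leaves no maximum below `p`; so `p` is the smallest
maximum, or `n` if there is none. The kinds of edges of `theta f` then correspond to
`SplicedFrom.eq`, `SplicedFrom.next` and `g p = 1`. -/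
theorem theta_eq_digraphOf (hn : 2 ≤ n) (f : FunClass n) (h : Chain n (extend f, n) (g, p))
    (hac : Acyclic g) : theta f = digraphOf n g := by
  have hmap := extend_isMap hn f
  have hgood := extend_good hn f
  have hg := h.good hgood
  have hs := h.splicedFrom hgood
  have hpm : ∀ r, IsMax (extend f) r → p ≤ r := fun r hr => by
    by_contra h1
    exact hac r hr.1 (hs.per r hr (by simpa using h1))
  simp only at hg hs
  have hmx : ∀ v, (v = n ∨ IsMax (extend f) v) → v ≠ p → p < v := by
    rintro v (rfl | hv) hvp
    · exact lt_of_le_of_ne hg.le (Ne.symm hvp)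
    · exact lt_of_le_of_ne (hpm v hv) (Ne.symm hvp)
  have hvert : ∀ r, IsMax (extend f) r → ∃ v : Vertex n, v.1 = r := fun r hr =>
    ⟨⟨r, by have := hr.inner hmap; omega⟩, rfl⟩
  have hmn : ∀ r, IsMax (extend f) r → r ≠ n := fun r hr => (hgood.lt r hr.1 hr.2.1).ne
  ext v w
  simp only [theta, digraphOf, IsFirstCycle, IsLastCycle, IsNextCycle, IsBackEdge,
    isRightEnd_iff f hn, graph_adj f hn]
  constructor
  · rintro (⟨⟨h1, h2⟩, h3⟩ | ⟨s, ⟨h1, h2, h3, h4⟩, -, -, h5⟩ | ⟨h1, s, ⟨h2, h3⟩, -, -, h4⟩ |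
      ⟨⟨h1, h2⟩, h3⟩ | ⟨h1, h2, h3⟩)
    · rw [hs.eq v.1 (fun h4 => h3 ⟨h4, h1, h2⟩) h1, h2]
    · obtain ⟨r, h6, h7, h8, h9⟩ := hs.next v.1 (hmx v.1 (Or.inr h1) (by
        have := hpm s.1 h2
        have : s.1 < v.1 := h3
        omega)) (Or.inr h1)
      obtain ⟨r, rfl⟩ := hvert r h6
      -- Both are the largest cycle maximum below `v`.
      have h10 : r.1 = s.1 := by
        have h11 := h8 s.1 h2
        have h12 : ¬ (s.1 < r.1 ∧ r.1 < v.1) := h4 r h6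
        have h13 : s.1 < v.1 := h3
        omega
      rw [h9, h10, h5]
    · obtain ⟨r, h6, h7, h8, h9⟩ := hs.next v.1 (hmx v.1 (Or.inl h1) (by
        have := hpm s.1 h2
        have := hmn s.1 h2
        have := s.2
        omega)) (Or.inl h1)
      obtain ⟨r, rfl⟩ := hvert r h6
      have h10 : r.1 = s.1 := by
        have h11 := h8 s.1 h2
        have h12 : r.1 ≤ s.1 := h3 r h6
        have := hmn s.1 h2
        have := s.2
        omega
      rw [h9, h10, h4]
    · have h4 : v.1 = p := by
        refine le_antisymm ?_ (hpm v.1 h1)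
        rcases hs.last with h5 | h5
        · rw [h5]; exact v.2.2
        · obtain ⟨r, rfl⟩ := hvert p h5
          exact h2 r h5
      rw [h4, hg.eq_one, h3]
    · have h4 : p = n := by
        rcases hs.last with h5 | h5
        · exact h5
        · obtain ⟨r, rfl⟩ := hvert p h5
          exact (h1 r h5).elim
      rw [h2.trans h4.symm, hg.eq_one, h3]
  · intro hvw
    by_cases hvp : v.1 = p
    · have hw : w.1 = 1 := by rw [← hvw, hvp, hg.eq_one]
      rcases hs.last with h1 | h1
      · refine Or.inr (Or.inr (Or.inr (Or.inr ⟨fun s h2 => ?_, hvp.trans h1, hw⟩)))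
        have := hpm s.1 h2
        have := hmn s.1 h2
        have := s.2
        omega
      · refine Or.inr (Or.inr (Or.inr (Or.inl ⟨⟨hvp ▸ h1, fun s h2 => ?_⟩, hw⟩)))
        exact Subtype.coe_le_coe.1 (hvp ▸ hpm s.1 h2)
    · by_cases hv : v.1 = n ∨ IsMax (extend f) v.1
      · obtain ⟨r, h6, h7, h8, h9⟩ := hs.next v.1 (hmx v.1 hv hvp) hv
        obtain ⟨r, rfl⟩ := hvert r h6
        rcases hv with hv | hv
        · refine Or.inr (Or.inr (Or.inl ⟨hv, r, ⟨h6, fun s h2 => ?_⟩, h6, hmn r.1 h6, ?_⟩))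
          · have h10 := h8 s.1 h2
            have := hmn s.1 h2
            have := s.2
            exact Subtype.coe_le_coe.1 (by omega)
          · rw [← h9, hvw]
        · exact Or.inr (Or.inl ⟨r, ⟨hv, h6, h7, fun u hu => h8 u.1 hu⟩, h6, hmn r.1 h6,
            by rw [← h9, hvw]⟩)
      · push Not at hv
        refine Or.inl ⟨⟨hv.1, ?_⟩, fun h => hv.2 h.1⟩
        rw [← hs.eq v.1 hv.2 hv.1, hvw]

/-! ### Trees -/

/-- The orbit is bounded, so some value repeats; a repeated value is periodic and hence `0`. -/
theorem Acyclic.reach_zero (hmap : IsMap n g) (hac : Acyclic g) (u : ℕ) : Reach g u 0 := by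
  have hle : ∀ k, g^[k] u < max u n + 1 := fun k => by
    cases k with
    | zero => simp only [Function.iterate_zero, id]; omega
    | succ k => rw [Function.iterate_succ_apply']; have := hmap.le (g^[k] u); omega
  obtain ⟨i, j, hij, h⟩ := Finite.exists_ne_map_eq_of_infinite
    (fun k : ℕ => (⟨g^[k] u, hle k⟩ : Fin (max u n + 1)))
  simp only [Fin.mk.injEq] at h
  have key : ∀ i j, i < j → g^[i] u = g^[j] u → Reach g u 0 := by
    intro i j hij h
    obtain ⟨d, rfl⟩ := Nat.exists_eq_add_of_lt hij
    have h1 : Per g (g^[i] u) := ⟨d, by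
      rw [← Function.iterate_succ_apply, ← Function.iterate_add_apply, h]
      congr 1
      omega⟩
    have h2 : g^[i] u = 0 := by
      by_contra h2
      exact hac _ h2 h1
    exact ⟨i, h2⟩
  rcases lt_or_gt_of_ne hij with h1 | h1
  · exact key i j h1 h
  · exact key j i h1 h.symm

theorem Acyclic.of_reach_zero (hmap : IsMap n g) (h : ∀ u, u ≤ n → Reach g u 0) : Acyclic g :=
  fun u h0 hu => h0 (hmap.reach_zero (hu.reach_symm (h u (hmap.per_inner hu h0).2.1)))

theorem isTree_digraphOf (hmap : IsMap n g) (hac : Acyclic g) :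
    IsTreeRootedAtOne (digraphOf n g) := by
  refine ⟨fun v hv w hw => ?_, fun v hv => ?_, fun v r hr => ?_⟩
  · simp only [digraphOf, hv, hmap.one] at hw
    have := w.2
    omega
  · have hv2 := v.2
    refine ⟨⟨g v.1, hmap.pos _ (by omega) hv2.2, hmap.le _⟩, rfl, fun w hw => ?_⟩
    exact Subtype.ext (Eq.symm hw)
  -- The vertices `2, …, n` are never sent to `0`, so an orbit that ends in `0` passes through `1`.
  · obtain ⟨k, hk⟩ := hac.reach_zero hmap v.1
    induction k generalizing v with
    | zero =>
      have : v.1 = 0 := hk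
      have := v.2
      omega
    | succ k ih =>
      have hv2 := v.2
      by_cases hv : v.1 = 1
      · rw [Subtype.ext (hv.trans hr.symm)]
      · let w : Vertex n := ⟨g v.1, hmap.pos _ (by omega) hv2.2, hmap.le _⟩
        exact .head (show (digraphOf n g).Adj v w from rfl) (ih w hk)

theorem exists_digraphOf_eq {T : Digraph (Vertex n)} (hn : 2 ≤ n) (hT : IsTreeRootedAtOne T) :
    ∃ g, IsMap n g ∧ Acyclic g ∧ digraphOf n g = T := by
  choose! t ht ht' using hT.unique_out
  set g : ℕ → ℕ := fun v => if h : 2 ≤ v ∧ v ≤ n then (t ⟨v, by omega⟩).1 else 0 with hg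
  have e : ∀ v : Vertex n, v.1 ≠ 1 → g v.1 = (t v).1 := fun v hv => by
    have := v.2
    simp only [hg]
    rw [dif_pos (by omega)]
  have hmap : IsMap n g := by
    refine ⟨?_, ?_, fun v hv hv' => ?_, fun v => ?_, fun v hv => ?_⟩ <;> simp only [hg]
    · rw [dif_neg (by omega)]
    · rw [dif_neg (by omega)]
    · rw [dif_pos ⟨hv, hv'⟩]; exact (t _).2.1
    · split_ifs
      · exact (t _).2.2
      · omega
    · rw [dif_neg (by omega)]
  have hadj : digraphOf n g = T := by
    ext v w
    simp only [digraphOf]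
    by_cases hv : v.1 = 1
    · rw [hv, hmap.one]
      refine ⟨fun h => ?_, fun h => (hT.root_out v hv w h).elim⟩
      have := w.2
      omega
    · rw [e v hv, ← Subtype.ext_iff]
      exact ⟨fun h => h ▸ ht v hv, fun h => (ht' v hv w h).symm⟩
  refine ⟨g, hmap, Acyclic.of_reach_zero hmap fun u hu => ?_, hadj⟩
  rcases Nat.eq_zero_or_pos u with rfl | h0
  · exact Reach.refl _ _
  · have h1 := hT.reach_root ⟨u, h0, hu⟩ ⟨1, le_rfl, by omega⟩ rfl
    suffices Reach g u 1 from by simpa [hmap.one] using this.tail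
    rw [← hadj] at h1
    have h2 : ∀ v w : Vertex n, Relation.ReflTransGen (digraphOf n g).Adj v w →
        Reach g v.1 w.1 := by
      intro v w h
      induction h with
      | refl => exact Reach.refl _ _
      | tail _ h ih =>
        rw [← (show _ = _ from h)]
        exact ih.tail
    exact h2 _ _ h1

theorem digraphOf_injective (hmap : IsMap n g) (hmap' : IsMap n g')
    (h : digraphOf n g = digraphOf n g') : g = g' := by
  funext v
  by_cases hv : 2 ≤ v ∧ v ≤ n
  · have h1 : (digraphOf n g).Adj ⟨v, by omega⟩ ⟨g v, hmap.pos v hv.1 hv.2, hmap.le v⟩ := rfl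
    rw [h] at h1
    exact Eq.symm h1
  · have h0 := hmap.zero
    have h0' := hmap'.zero
    have h1 := hmap.one
    have h1' := hmap'.one
    rcases lt_or_ge n v with h6 | h6
    · rw [hmap.big v h6, hmap'.big v h6]
    · obtain rfl | rfl : v = 0 ∨ v = 1 := by omega
      · rw [h0, h0']
      · rw [h1, h1']

/-! ### The bijection -/

/-- Both vertices lie on the orbit of `n`, and after a vertex that is sent to `1` only `1` and `0`
follow. -/
theorem Good.unique {p' : ℕ} (h : Good n g p) (h' : Good n g p') : p = p' := by
  have key : ∀ {p p'}, Good n g p → Good n g p' → Reach g p p' → p = p' := by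
    intro p p' h h' hr
    rcases hr.eq_or_head with h1 | h1
    · exact h1
    · rw [h.eq_one] at h1
      have := h.map.reach_one h1
      have := h'.two_le
      omega
  rcases h.reach.linear h'.reach with h1 | h1
  · exact key h h' h1
  · exact (key h' h h1).symm

theorem exists_splice (h : ¬ Acyclic g) (hg : Good n g p) : ∃ g' m, Splice g p g' m := by
  classical
  simp only [Acyclic, not_forall, not_not] at h
  obtain ⟨u, h0, hu⟩ := h
  let S := (Finset.range p).filter fun u => u ≠ 0 ∧ Per g u
  have hS : ∀ u, u ∈ S ↔ u ≠ 0 ∧ Per g u := fun u => by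
    simp only [S, Finset.mem_filter, Finset.mem_range, and_iff_right_iff_imp]
    exact fun h => hg.lt u h.1 h.2
  have hne : S.Nonempty := ⟨u, (hS u).2 ⟨h0, hu⟩⟩
  have hmem := (hS _).1 (S.max'_mem hne)
  exact ⟨_, S.max' hne, hmem.2, hmem.1, fun v hv0 hv => S.le_max' v ((hS v).2 ⟨hv0, hv⟩), rfl⟩

theorem Good.exists_chain (hg : Good n g p) : ∃ g' p', Chain n (g, p) (g', p') ∧ Acyclic g' := by
  induction p using Nat.strong_induction_on generalizing g with
  | _ p ih =>
    by_cases h : Acyclic g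
    · exact ⟨g, p, .refl, h⟩
    · obtain ⟨g', m, hs⟩ := exists_splice h hg
      obtain ⟨g'', p', h1, h2⟩ := ih m (hs.lt hg) (hs.good hg)
      exact ⟨g'', p', .head ⟨hg, hs⟩ h1, h2⟩

theorem Good.cut_iterate {j d : ℕ} (hg : Good n g p) (hd : g^[j + 1 + d] n = p)
    (hle : ∀ e ≤ d, g^[j + 1 + e] n ≤ p) (hlt : p < g^[j] n) :
    Good n (Function.update (Function.update g p (g (g^[j] n))) (g^[j] n) 1) (g^[j] n) ∧
      Splice (Function.update (Function.update g p (g (g^[j] n))) (g^[j] n) 1) (g^[j] n) g p := by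
  have h1 : ∀ e, g^[e] (g (g^[j] n)) = g^[j + 1 + e] n := fun e => by
    rw [← Function.iterate_succ_apply' g, ← Function.iterate_add_apply]
    congr 1
    omega
  refine hg.cut ⟨j, rfl⟩ hlt ⟨d, (h1 d).trans hd⟩ ?_
  rintro z ⟨e, rfl⟩ hz
  rw [h1] at hz ⊢
  rcases le_or_gt e d with h2 | h2
  · exact hle e h2
  -- Past its visit to `p` the orbit cannot return there, since `p` would be periodic and so smaller
  -- than itself.
  · exfalso
    obtain ⟨c, rfl⟩ := Nat.exists_eq_add_of_lt h2
    have h3 : Reach g (g p) (g^[j + 1 + (d + c + 1)] n) := ⟨c, by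
      rw [← hd, ← Function.iterate_succ_apply, ← Function.iterate_add_apply]
      congr 1
      omega⟩
    exact (hg.lt p (by have := hg.two_le; omega) (h3.trans hz)).ne rfl

/-- For `p < n` the path starts above `p`. Its last vertex exceeding `p` becomes the new `p`, so `n
- p` decreases. Position `k` holds `p` itself, hence the search up to `k - 1`. -/
theorem Good.exists_chain_to (hg : Good n g p) : ∃ g₀, Good n g₀ n ∧ Chain n (g₀, n) (g, p) := by
  induction hm : n - p using Nat.strong_induction_on generalizing g p with
  | _ m ih =>
    rcases hg.le.lt_or_eq with hpn | rfl
    · obtain ⟨k, hk⟩ := hg.reach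
      have hk0 : k ≠ 0 := by rintro rfl; exact hpn.ne' hk
      set j := Nat.findGreatest (fun j => p < g^[j] n) (k - 1) with hj
      have hj1 : p < g^[j] n := Nat.findGreatest_spec (P := fun j => p < g^[j] n)
        (Nat.zero_le _) hpn
      have hj2 : j ≤ k - 1 := Nat.findGreatest_le _
      have hle : ∀ e ≤ k - (j + 1), g^[j + 1 + e] n ≤ p := fun e he => by
        rcases he.lt_or_eq with h1 | h1
        · have := Nat.findGreatest_is_greatest (P := fun j => p < g^[j] n) (n := k - 1)
            (k := j + 1 + e) (by omega) (by omega)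
          omega
        · rw [h1, show j + 1 + (k - (j + 1)) = k by omega, hk]
      obtain ⟨h1, h2⟩ := hg.cut_iterate (d := k - (j + 1))
        (by rw [show j + 1 + (k - (j + 1)) = k by omega, hk]) hle hj1
      obtain ⟨g₀, h3, h4⟩ := ih (n - g^[j] n) (by omega) h1 rfl
      exact ⟨g₀, h3, h4.tail ⟨h1, h2⟩⟩
    · exact ⟨g, hg, .refl⟩

theorem Acyclic.exists_good (hn : 2 ≤ n) (hmap : IsMap n g) (hac : Acyclic g) :
    ∃ p, Good n g p := by
  obtain ⟨k, hk⟩ := hac.reach_zero hmap n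
  have key : ∀ k u, 2 ≤ u → u ≤ n → g^[k] u = 0 → ∃ p, 2 ≤ p ∧ g p = 1 ∧ Reach g u p := by
    intro k
    induction k with
    | zero => intro u h1 h2 h3; simp only [Function.iterate_zero, id] at h3; omega
    | succ k ih =>
      intro u h1 h2 h3
      by_cases h4 : g u = 1
      · exact ⟨u, h1, h4, Reach.refl _ _⟩
      · have h5 := hmap.pos u h1 h2
        obtain ⟨p, h6, h7, h8⟩ := ih (g u) (by omega) (hmap.le u) h3
        exact ⟨p, h6, h7, h8.head⟩
  obtain ⟨p, h1, h2, h3⟩ := key k n hn le_rfl hk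
  exact ⟨p, hmap, h1, h2, h3, fun u h0 hu => (hac u h0 hu).elim⟩

theorem exists_theta_eq (hn : 2 ≤ n) (f : FunClass n) :
    ∃ g p, Chain n (extend f, n) (g, p) ∧ Acyclic g ∧ IsMap n g ∧ theta f = digraphOf n g := by
  obtain ⟨g, p, h1, h2⟩ := (extend_good hn f).exists_chain
  exact ⟨g, p, h1, h2, (h1.good (extend_good hn f)).map, theta_eq_digraphOf hn f h1 h2⟩

theorem theta_mem (hn : 2 ≤ n) (f : FunClass n) : theta f ∈ rootedTrees n := by
  obtain ⟨g, p, -, h2, h3, h4⟩ := exists_theta_eq hn f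
  rw [h4]
  exact isTree_digraphOf h3 h2

/-- The tree determines `g`, which determines `p`; the pair determines the start of the chain. -/
theorem theta_injective (hn : 2 ≤ n) : Function.Injective (theta (n := n)) := by
  intro f f' h
  obtain ⟨g, p, h1, h2, h3, h4⟩ := exists_theta_eq hn f
  obtain ⟨g', p', h1', h2', h3', h4'⟩ := exists_theta_eq hn f'
  obtain rfl : g = g' := digraphOf_injective h3 h3' (by rw [← h4, h, h4'])
  obtain rfl : p = p' := (h1.good (extend_good hn f)).unique (h1'.good (extend_good hn f'))
  exact extend_injective (Chain.start_unique h1 h1')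

theorem theta_surjective (hn : 2 ≤ n) {T : Digraph (Vertex n)} (hT : T ∈ rootedTrees n) :
    ∃ f : FunClass n, theta f = T := by
  obtain ⟨g, h1, h2, rfl⟩ := exists_digraphOf_eq hn hT
  obtain ⟨p, hp⟩ := h2.exists_good hn h1
  obtain ⟨g₀, h3, h4⟩ := hp.exists_chain_to
  obtain ⟨f, rfl⟩ := exists_extend_eq h3.map h3.eq_one
  exact ⟨f, theta_eq_digraphOf hn f h4 h2⟩

/-- The bijection `Θ`. -/
noncomputable def thetaEquiv (hn : 2 ≤ n) : FunClass n ≃ rootedTrees n :=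
  Equiv.ofBijective (fun f => ⟨theta f, theta_mem hn f⟩)
    ⟨fun _ _ h => theta_injective hn (congrArg Subtype.val h), fun T => by
      obtain ⟨f, hf⟩ := theta_surjective hn T.2
      exact ⟨f, Subtype.ext hf⟩⟩

end

/-! ### Finding the periodic points -/

/-- The number of zeros of `f` on `0, …, n`. -/
def zeros (n : ℕ) (f : ℕ → ℕ) : ℕ := ((Finset.range (n + 1)).filter fun u => f u = 0).card

/-- The number of non-zeros of `f` on `0, …, n`. -/
def nonzeros (n : ℕ) (f : ℕ → ℕ) : ℕ := ((Finset.range (n + 1)).filter fun u => f u ≠ 0).card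

section

variable {n : ℕ} {f g g' g₀ : ℕ → ℕ} {v x : ℕ}

theorem zeros_le (n : ℕ) (f : ℕ → ℕ) : zeros n f ≤ n + 1 :=
  (Finset.card_filter_le _ _).trans_eq (Finset.card_range _)

theorem nonzeros_le (n : ℕ) (f : ℕ → ℕ) : nonzeros n f ≤ n + 1 :=
  (Finset.card_filter_le _ _).trans_eq (Finset.card_range _)

theorem zeros_update_lt (hv : v ≤ n) (h : f v = 0) (hx : x ≠ 0) :
    zeros n (Function.update f v x) < zeros n f := by
  refine Finset.card_lt_card ⟨fun u hu => ?_, fun hs => ?_⟩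
  · simp only [Finset.mem_filter, Function.update_apply] at hu ⊢
    split_ifs at hu
    · exact (hx hu.2).elim
    · exact hu
  · have h1 := hs (Finset.mem_filter.2 ⟨Finset.mem_range.2 (by omega : v < n + 1), h⟩)
    simp [hx] at h1

theorem nonzeros_update_lt (hv : v ≤ n) (h : f v ≠ 0) :
    nonzeros n (Function.update f v 0) < nonzeros n f := by
  refine Finset.card_lt_card ⟨fun u hu => ?_, fun hs => ?_⟩
  · simp only [Finset.mem_filter, Function.update_apply] at hu ⊢
    split_ifs at hu
    · exact (hu.2 rfl).elim
    · exact hu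
  · have h1 := hs (Finset.mem_filter.2 ⟨Finset.mem_range.2 (by omega : v < n + 1), h⟩)
    simp at h1

/-- The state of the search for periodic points: from each of the vertices `2, 3, …` a path is
followed, whose vertices get the starting vertex as their colour, until a coloured vertex is met;
if a cycle has been closed, it is followed once more and its vertices are marked. The present path
started in `i` and has reached `v`. -/
structure Search (n : ℕ) (g : ℕ → ℕ) (i v : ℕ) (col mark : ℕ → ℕ) : Prop where
  two_le : 2 ≤ i
  i_le : i ≤ n
  v_le : v ≤ n
  col_le : ∀ u, col u ≤ i
  old : ∀ u, col u ≠ 0 → col u ≠ i → col (g u) ≠ 0 ∧ col (g u) ≠ i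
  old_per : ∀ u, col u ≠ 0 → col u ≠ i → Per g u → mark u ≠ 0
  reach : ∀ u, col u = i → Reach g (g u) v
  cur : ∀ u, col u = i → col (g u) = i ∨ g u = v
  mark_cur : ∀ u, mark u ≠ 0 → col u = i → mark (g u) ≠ 0 ∨ g u = v
  mark_v : ∀ u, mark u ≠ 0 → col u = i → col v = i
  mark_col : ∀ u, mark u ≠ 0 → col u ≠ 0
  mark_per : ∀ u, mark u ≠ 0 → Per g u
  done : ∀ u, 2 ≤ u → u < i → col u ≠ 0
  start : v = i ∨ col i ≠ 0
  fresh : i = n → ∀ u, col u ≠ n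

variable {i : ℕ} {col mark : ℕ → ℕ}

theorem Search.init (hn : 2 ≤ n) : Search n g 2 2 (fun _ => 0) (fun _ => 0) := by
  constructor <;> intros <;> simp_all <;> omega

theorem Search.colour_step (hmap : IsMap n g) (h : Search n g i v col mark) (hi' : i < n)
    (hv : col v = 0) :
    Search n g i (g v) (Function.update col v i) mark := by
  have hi : i ≠ 0 := by have := h.two_le; omega
  -- A marked vertex of the present colour would force `v` to be coloured, so marking has not begun
  -- on this path.
  have hno : ∀ u, mark u ≠ 0 → u ≠ v ∧ col u ≠ i := fun u hu =>
    ⟨by rintro rfl; exact h.mark_col u hu hv, fun h1 => hi (by rw [← h.mark_v u hu h1, hv])⟩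
  refine ⟨h.two_le, h.i_le, hmap.le v, fun u => ?_, fun u h1 h2 => ?_, fun u h1 h2 h3 => ?_,
    fun u h1 => ?_, fun u h1 => ?_, fun u h1 h2 => ?_, fun u h1 h2 => ?_, fun u h1 => ?_,
    h.mark_per, fun u h1 h2 => ?_, ?_, fun h1 => (hi'.ne h1).elim⟩
  · have := h.col_le u
    grind
  · have := h.old u
    grind
  · have := h.old_per u
    grind
  · by_cases hu : u = v
    · rw [hu]; exact Reach.refl _ _
    · rw [Function.update_of_ne hu] at h1
      exact (h.reach u h1).tail
  · have := h.cur u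
    grind
  · have := hno u h1
    grind
  · have := hno u h1
    grind
  · have := h.mark_col u h1
    grind
  · have := h.done u h1 h2
    grind
  · have := h.start
    grind

/-- Meeting the present colour again closes a cycle: `Search.reach` at `v` itself says that `v` is
periodic. -/
theorem Search.mark_step (hmap : IsMap n g) (h : Search n g i v col mark) (hi' : i < n)
    (hv : col v = i) :
    Search n g i (g v) col (Function.update mark v 1) := by
  have hi : i ≠ 0 := by have := h.two_le; omega
  refine ⟨h.two_le, h.i_le, hmap.le v, h.col_le, h.old, fun u h1 h2 h3 => ?_,
    fun u h1 => (h.reach u h1).tail, fun u h1 => ?_, fun u h1 h2 => ?_, fun u h1 h2 => ?_,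
    fun u h1 => ?_, fun u h1 => ?_, h.done, ?_,
    fun h1 => (hi'.ne h1).elim⟩
  · have := h.old_per u h1 h2 h3
    grind
  · have := h.cur u h1
    grind
  · have := h.mark_cur u
    grind
  · have := h.cur v hv
    grind
  · have := h.mark_col u
    grind
  · by_cases hu : u = v
    · rw [hu]; exact h.reach v hv
    · rw [Function.update_of_ne hu] at h1
      exact h.mark_per u h1
  · have := h.start
    grind

/-- A periodic vertex `u` of colour `i` is reached from `v`. If `v` has an older colour, so has
everything after it, which excludes `u`. Otherwise `v` is marked, and the marked vertices of colour
`i` are closed under `g`, so `u` is marked. -/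
theorem Search.next_step (h : Search n g i v col mark) (hi : i < n) (hv : col v ≠ 0)
    (hv' : col v = i → mark v ≠ 0) : Search n g (i + 1) (i + 1) col mark := by
  have key : ∀ u, col u = i → Per g u → mark u ≠ 0 := by
    intro u h1 h2
    have h3 : Reach g v u := h2.reach_symm (h.reach u h1).head
    by_cases h4 : col v = i
    · refine (h3.induct (S := fun x => mark x ≠ 0 ∧ col x = i) ⟨hv' h4, h4⟩ ?_).1
      intro x hx
      have := h.cur x hx.2
      have := h.mark_cur x hx.1 hx.2
      grind
    · exact ((h3.induct (S := fun x => col x ≠ 0 ∧ col x ≠ i) ⟨hv, h4⟩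
        fun x hx => h.old x hx.1 hx.2).2 h1).elim
  have hlt : ∀ u, col u ≠ i + 1 := fun u => by have := h.col_le u; omega
  refine ⟨by have := h.two_le; omega, hi, hi, fun u => ?_, fun u h1 _ => ?_, fun u h1 _ h3 => ?_,
    fun u h1 => (hlt u h1).elim, fun u h1 => (hlt u h1).elim, fun u _ h1 => (hlt u h1).elim,
    fun u _ h1 => (hlt u h1).elim, h.mark_col, h.mark_per, fun u h1 h2 => ?_, Or.inl rfl,
    fun h1 u => h1 ▸ hlt u⟩
  · have := h.col_le u
    omega
  · refine ⟨?_, hlt _⟩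
    by_cases h4 : col u = i
    · have := h.cur u h4
      grind
    · exact (h.old u h1 h4).1
  · by_cases h4 : col u = i
    · exact key u h4 h3
    · exact h.old_per u h1 h4 h3
  · by_cases h4 : u = i
    · have := h.start
      grind
    · exact h.done u h1 (by omega)

theorem Search.mark_iff (h : Search n g n v col mark) (hg : Good n g n) {u : ℕ} (hu : 2 ≤ u) :
    mark u ≠ 0 ↔ Per g u := by
  refine ⟨h.mark_per u, fun h1 => ?_⟩
  exact h.old_per u (h.done u hu (hg.lt u (by omega) h1)) (h.fresh rfl u) h1

end

section

variable {n : ℕ} {g g₀ : ℕ → ℕ}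

/-! ### Splicing in the cycles one after the other -/

/-- The state of the loop that splices in the cycles: all vertices on cycles are at most `i`, the
last vertex before `1` is `p`, and `mark` indicates the vertices on cycles, together with those on
the path that starts in `v`. -/
structure Splicing (n : ℕ) (g₀ g : ℕ → ℕ) (i p v : ℕ) (mark : ℕ → ℕ) : Prop where
  good : Good n g p
  chain : Chain n (g₀, n) (g, p)
  lt : i < p
  one_le : 1 ≤ v
  v_le : v ≤ n
  reach : Reach g v 1
  per_le : ∀ u, u ≠ 0 → Per g u → u ≤ i
  mark_iff : ∀ u, 2 ≤ u → u ≤ n → (mark u ≠ 0 ↔ Per g u ∨ Reach g v u)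

variable {i p v : ℕ} {mark : ℕ → ℕ}

/-- As `v` leads to `1`, it is not periodic; so it neither lies on a cycle nor recurs on the rest of
its path, and its mark can be erased. -/
theorem Splicing.clear_step (h : Splicing n g₀ g i p v mark) (hv : 1 < v) :
    mark v ≠ 0 ∧ Splicing n g₀ g i p (g v) (Function.update mark v 0) := by
  have hmap := h.good.map
  have hnp : ¬ Per g v := fun h1 => by
    have := hmap.per_inner (h1.of_reach h.reach) one_ne_zero
    omega
  refine ⟨(h.mark_iff v hv h.v_le).2 (Or.inr (Reach.refl _ _)), h.good, h.chain, h.lt,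
    hmap.pos v hv h.v_le, hmap.le v, h.reach.eq_or_head.resolve_left (by omega), h.per_le,
    fun u hu hun => ?_⟩
  by_cases huv : u = v
  · subst huv
    simp only [Function.update_self, ne_eq, not_true_eq_false, false_iff, not_or]
    exact ⟨hnp, hnp⟩
  · rw [Function.update_of_ne huv, h.mark_iff u hu hun]
    refine or_congr_right ⟨fun h1 => h1.eq_or_head.resolve_left (Ne.symm huv), Reach.head⟩

theorem Splicing.mark_iff_per (h : Splicing n g₀ g i p v mark) (hv : ¬ 1 < v) {u : ℕ} (hu : 2 ≤ u)
    (hun : u ≤ n) : mark u ≠ 0 ↔ Per g u := by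
  have hv1 : v = 1 := by have := h.one_le; omega
  rw [h.mark_iff u hu hun, or_iff_left]
  intro h1
  have := h.good.map.reach_one (hv1 ▸ h1)
  omega

theorem Splicing.skip_step (h : Splicing n g₀ g i p v mark) (hv : ¬ 1 < v) (hi : 1 < i)
    (hm : mark i = 0) : Splicing n g₀ g (i - 1) p v mark := by
  have hlt := h.lt
  have hle := h.good.le
  refine ⟨h.good, h.chain, by omega, h.one_le, h.v_le, h.reach, fun u h0 hu => ?_, h.mark_iff⟩
  have h1 := h.per_le u h0 hu
  have h2 : u ≠ i := by
    rintro rfl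
    exact (h.mark_iff_per hv hi (by omega)).2 hu hm
  omega

/-- With no erasing pending, the marks are exactly the periodic points, and the scan comes from
above, so `i` is the largest of them. Its cycle becomes the path from `g i`, whose marks are now to
be erased. -/
theorem Splicing.splice_step (h : Splicing n g₀ g i p v mark) (hv : ¬ 1 < v) (hi : 1 < i)
    (hm : mark i ≠ 0) :
    Splicing n g₀ (Function.update (Function.update g p (g i)) i 1) (i - 1) i (g i) mark := by
  have hlt := h.lt
  have hle := h.good.le
  have hg := h.good
  have hper := (h.mark_iff_per hv hi (by omega)).1 hm
  have hs : Splice g p (Function.update (Function.update g p (g i)) i 1) i :=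
    ⟨hper, by omega, h.per_le, rfl⟩
  set g' := Function.update (Function.update g p (g i)) i 1 with hg'
  have hcyc := hs.reach_cycle hg
  have hlast := hs.apply_self
  have hprev := hs.apply_prev hg
  refine ⟨hs.good hg, h.chain.tail ⟨hg, hs⟩, by omega, hg.map.pos i hi (by omega), hg.map.le i,
    hlast ▸ hcyc.tail, fun u h0 hu => ?_, fun u hu hun => ?_⟩
  · have h1 := h.per_le u h0 (hs.per_of_per hg hu).1
    have h2 : u ≠ i := by
      rintro rfl
      exact (((hs.isMap hg).per_inner hu h0).2.2.2) hlast
    omega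
  · rw [h.mark_iff_per hv hu hun]
    constructor
    · intro h1
      by_cases h2 : Reach g i u
      · right
        suffices Reach g' (g i) u ∧ Per g u from this.1
        refine Reach.induct (S := fun x => Reach g' (g i) x ∧ Per g x) (hper.trans h2)
          ⟨Reach.refl _ _, hper.of_reach (Reach.step _ _)⟩ fun x hx =>
            ⟨?_, hx.2.of_reach (Reach.step _ _)⟩
        by_cases hxi : x = i
        · rw [hxi]; exact Reach.refl _ _
        · have hxp : x ≠ p := by
            rintro rfl
            exact (hg.lt x (by omega) hx.2).ne rfl
          rw [← hs.apply_of_ne hxp hxi]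
          exact hx.1.tail
      · exact Or.inl ((hs.per_iff hg).2 ⟨h1, h2⟩)
    · rintro (h1 | h1)
      · exact (hs.per_of_per hg h1).1
      · rw [← hprev] at h1
        exact (hs.le_of_reach hg h1).2.resolve_right (by omega)

theorem Splicing.acyclic (h : Splicing n g₀ g i p v mark) (hi : ¬ 1 < i) : Acyclic g := by
  intro u h0 hu
  have := h.per_le u h0 hu
  have := h.good.map.per_inner hu h0
  omega

theorem Splicing.init (hn : 2 ≤ n) (hg : Good n g n)
    (hm : ∀ u, 2 ≤ u → (mark u ≠ 0 ↔ Per g u)) : Splicing n g g (n - 1) n 1 mark := by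
  refine ⟨hg, .refl, by omega, le_rfl, by omega, Reach.refl _ _, fun u h0 hu => ?_,
    fun u hu hun => ?_⟩
  · have := hg.lt u h0 hu
    omega
  · rw [hm u hu, or_iff_left]
    intro h1
    have := hg.map.reach_one h1
    omega

/-! ### Cutting off the cycles one after the other -/

variable {stk : ℕ → ℕ} {t : ℕ → ℕ} {q j x : ℕ}

/-- Without cycles the iterates up to `j` are distinct elements of `1, …, n`. This bounds the height
of the stack. -/
theorem Acyclic.le_of_iterate (hmap : IsMap n g) (hac : Acyclic g) (h : 2 ≤ g^[j] n) : j ≤ n := by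
  have h1 : ∀ k ≤ j, 2 ≤ g^[k] n := by
    intro k hk
    by_contra h2
    have h3 : Reach g (g^[k] n) (g^[j] n) := ⟨j - k, by
      rw [← Function.iterate_add_apply, Nat.sub_add_cancel hk]⟩
    obtain h4 | h4 : g^[k] n = 0 ∨ g^[k] n = 1 := by omega
    · rw [h4] at h3
      have := hmap.reach_zero h3
      omega
    · rw [h4] at h3
      have := hmap.reach_one h3
      omega
  have h2 : Set.InjOn (fun k => g^[k] n) (Finset.range (j + 1) : Set ℕ) := by
    have key : ∀ a b, b ≤ j → a < b → g^[a] n ≠ g^[b] n := by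
      intro a b hb hab he
      have h3 := h1 a (by omega)
      refine hac (g^[a] n) (by omega) ⟨b - a - 1, ?_⟩
      rw [← Function.iterate_succ_apply, ← Function.iterate_add_apply, he]
      congr 1
      omega
    intro a ha b hb he
    simp only [Finset.coe_range, Set.mem_Iio] at ha hb
    by_contra hne
    rcases lt_or_gt_of_ne hne with h3 | h3
    · exact key a b (by omega) h3 he
    · exact key b a (by omega) h3 he.symm
  have h3 := Finset.card_le_card_of_injOn (t := Finset.Icc 1 n) (fun k => g^[k] n)
    (fun k hk => by
      have h4 := h1 k (by have := Finset.mem_range.1 hk; omega)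
      exact Finset.mem_Icc.2 ⟨show 1 ≤ g^[k] n by omega, hmap.reach_le ⟨k, rfl⟩ le_rfl⟩) h2
  simp only [Finset.card_range, Nat.card_Icc] at h3
  omega

/-- The state of the loop that cuts off cycles: the path from `n` to `p` has its first `j + 1`
vertices on the stack, and all vertices from there to `p` are at most `p`. -/
structure Cutting (n : ℕ) (t : ℕ → ℕ) (q : ℕ) (g : ℕ → ℕ) (p j : ℕ) (stk : ℕ → ℕ) : Prop where
  good : Good n g p
  chain : Chain n (g, p) (t, q)
  stack : ∀ k ≤ j, stk k = g^[k] n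
  max : ∃ d, g^[j + d] n = p ∧ ∀ e ≤ d, g^[j + e] n ≤ p

theorem Cutting.skip_step (h : Cutting n t q g p (j + 1) stk) (hx : stk j ≤ p) :
    Cutting n t q g p j stk := by
  obtain ⟨d, h1, h2⟩ := h.max
  refine ⟨h.good, h.chain, fun k hk => h.stack k (by omega), d + 1, ?_, fun e he => ?_⟩
  · rw [← h1]; congr 1; omega
  · rcases e with _ | e
    · rw [h.stack j (by omega)] at hx
      exact hx
    · have := h2 e (by omega)
      rwa [show j + 1 + e = j + (e + 1) by omega] at this

theorem Cutting.cut_step (h : Cutting n t q g p (j + 1) stk) (hx : p < stk j) :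
    Cutting n t q (Function.update (Function.update g p (g (stk j))) (stk j) 1) (stk j) j stk := by
  obtain ⟨d, h1, h2⟩ := h.max
  have hxj := h.stack j (by omega)
  have hp2 := h.good.two_le
  obtain ⟨h3, h4⟩ := h.good.cut_iterate h1 h2 (by omega)
  rw [← hxj] at h3 h4
  set g' := Function.update (Function.update g p (g (stk j))) (stk j) 1 with hg'
  -- A value that repeats is periodic and so below `p`. Hence `p` and `stk j` occur only once on the
  -- path, and redirecting them leaves the first `j + 1` entries of the stack valid.
  have hper : ∀ a b, a < b → g^[a] n = g^[b] n → p ≤ g^[a] n → False := by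
    intro a b hab he hle
    have h5 := h.good.lt (g^[a] n) (by omega) ⟨b - a - 1, by
      rw [← Function.iterate_succ_apply, ← Function.iterate_add_apply, he]
      congr 1
      omega⟩
    omega
  have hit : ∀ k ≤ j, g'^[k] n = g^[k] n := by
    intro k hk
    induction k with
    | zero => rfl
    | succ k ih =>
      rw [Function.iterate_succ_apply', Function.iterate_succ_apply', ih (by omega), hg',
        Function.update_of_ne, Function.update_of_ne]
      · intro h5
        exact hper k (j + 1 + d) (by omega) (h5.trans h1.symm) h5.ge
      · intro h5
        exact hper k j (by omega) (h5.trans hxj) (by omega)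
  refine ⟨h3, .head ⟨h3, h4⟩ h.chain, fun k hk => ?_, 0, ?_, fun e he => ?_⟩
  · rw [hit k hk, h.stack k (by omega)]
  · rw [Nat.add_zero, hit j le_rfl, hxj]
  · rw [Nat.le_zero.1 he, Nat.add_zero, hit j le_rfl, hxj]

theorem Cutting.eq_of_zero (h : Cutting n t q g p 0 stk) : p = n := by
  obtain ⟨d, -, h2⟩ := h.max
  exact le_antisymm h.good.le (h2 0 (Nat.zero_le _))

theorem Cutting.init (hmap : IsMap n t) (hac : Acyclic t)
    (hstk : ∀ k ≤ j, stk k = t^[k] n ∧ 2 ≤ t^[k] n) (hj : t^[j + 1] n = 1) :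
    Cutting n t (stk j) t (stk j) j stk := by
  obtain ⟨h1, h2⟩ := hstk j le_rfl
  refine ⟨⟨hmap, by omega, ?_, ⟨j, h1.symm⟩, fun u h0 hu => (hac u h0 hu).elim⟩, .refl,
    fun k hk => (hstk k hk).1, 0, h1.symm, fun e he => ?_⟩
  · rw [h1, ← Function.iterate_succ_apply' t, hj]
  · rw [Nat.le_zero.1 he, Nat.add_zero, h1]

end

/-! ### Lists of pairs -/

/-- `L` lists the pairs `(v, g v)` with `2 ≤ v < m`. -/
def Lists (g : ℕ → ℕ) (m : ℕ) (L : List (ℕ × ℕ)) : Prop :=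
  L.Nodup ∧ ∀ p, p ∈ L ↔ 2 ≤ p.1 ∧ p.1 < m ∧ p.2 = g p.1

/-- The list of the pairs `(v, g v)` with `2 ≤ v < m`, in increasing order. -/
def pairList (g : ℕ → ℕ) (m : ℕ) : List (ℕ × ℕ) :=
  (List.range' 2 (m - 2)).map fun v => (v, g v)

section

variable {n m : ℕ} {g : ℕ → ℕ} {L : List (ℕ × ℕ)}

theorem isEdgeList_digraphOf (hmap : IsMap n g) :
    IsEdgeList (digraphOf n g) L ↔ Lists g (n + 1) L := by
  refine and_congr_right fun _ => forall_congr' fun p => ?_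
  refine iff_congr Iff.rfl ⟨?_, fun ⟨h1, h2, h3⟩ => ?_⟩
  · rintro ⟨v, w, h, rfl⟩
    simp only [digraphOf] at h
    have hv := v.2
    have hw := w.2
    refine ⟨?_, by simp only; omega, h.symm⟩
    have h1 : v.1 ≠ 1 := fun h1 => by rw [h1, hmap.one] at h; omega
    simp only
    omega
  · exact ⟨⟨p.1, by omega⟩, ⟨g p.1, hmap.pos _ h1 (by omega), hmap.le _⟩, rfl,
      Prod.ext rfl h3⟩

theorem isEdgeList_graph (hn : 2 ≤ n) (f : FunClass n) :
    IsEdgeList (graph f) L ↔ Lists (extend f) n L := by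
  have hmap := extend_isMap hn f
  refine and_congr_right fun _ => forall_congr' fun p => ?_
  refine iff_congr Iff.rfl ⟨?_, fun ⟨h1, h2, h3⟩ => ?_⟩
  · rintro ⟨v, w, h, rfl⟩
    obtain ⟨h0, h⟩ := (graph_adj f hn v w).1 h
    have hv := v.2
    have hw := w.2
    refine ⟨?_, by simp only; omega, h.symm⟩
    have h1 : v.1 ≠ 1 := fun h1 => by rw [h1, hmap.one] at h; omega
    simp only
    omega
  · exact ⟨⟨p.1, by omega⟩, ⟨extend f p.1, hmap.pos _ h1 (by omega), hmap.le _⟩,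
      (graph_adj f hn _ _).2 ⟨h2.ne, rfl⟩, Prod.ext rfl h3⟩

theorem Lists.length (h : Lists g m L) : L.length = m - 2 := by
  have h1 : L.toFinset = (Finset.Ico 2 m).image fun v => (v, g v) := by
    ext p
    simp only [List.mem_toFinset, h.2, Finset.mem_image, Finset.mem_Ico]
    exact ⟨fun h => ⟨p.1, ⟨h.1, h.2.1⟩, Prod.ext rfl h.2.2.symm⟩, by
      rintro ⟨v, h, rfl⟩; exact ⟨h.1, h.2, rfl⟩⟩
  rw [← List.toFinset_card_of_nodup h.1, h1,
    Finset.card_image_of_injective _ (fun a b h => congrArg Prod.fst h), Nat.card_Ico]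

theorem lists_pairList (g : ℕ → ℕ) (m : ℕ) : Lists g m (pairList g m) := by
  refine ⟨(List.nodup_range' (s := 2) (n := m - 2)).map fun a b h => congrArg Prod.fst h,
    fun p => ?_⟩
  simp only [pairList, List.mem_map, List.mem_range'_1]
  constructor
  · rintro ⟨v, h, rfl⟩
    exact ⟨h.1, by simp only; omega, rfl⟩
  · rintro ⟨h1, h2, h3⟩
    exact ⟨p.1, by omega, Prod.ext rfl h3.symm⟩

theorem pairwise_pairList (g : ℕ → ℕ) (m : ℕ) :
    (pairList g m).Pairwise fun p q => p.1 < q.1 := by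
  rw [pairList, List.pairwise_map]
  exact List.pairwise_lt_range'

theorem length_encode (n : ℕ) (L : List (ℕ × ℕ)) : (encode n L).length = 2 * L.length + 1 := by
  simp only [encode, List.length_cons, Nat.add_right_cancel_iff]
  induction L with
  | nil => rfl
  | cons p L ih =>
    simp only [List.flatMap_cons, List.length_append, List.length_cons, List.length_nil, ih]
    omega

theorem getElem?_flatMap_pair (L : List (ℕ × ℕ)) (k : ℕ) :
    (L.flatMap fun p => [p.1, p.2])[2 * k]? = L[k]?.map Prod.fst ∧
    (L.flatMap fun p => [p.1, p.2])[2 * k + 1]? = L[k]?.map Prod.snd := by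
  induction L generalizing k with
  | nil => simp
  | cons p L ih =>
    rcases k with _ | k
    · simp
    · simp only [List.flatMap_cons, List.cons_append, List.nil_append, Nat.mul_succ,
        List.getElem?_cons_succ]
      exact ih k

theorem encode_getD (n : ℕ) (L : List (ℕ × ℕ)) {k : ℕ} (hk : k < L.length) :
    (encode n L).getD (1 + 2 * k) 0 = L[k].1 ∧ (encode n L).getD (1 + 2 * k + 1) 0 = L[k].2 := by
  obtain ⟨h1, h2⟩ := getElem?_flatMap_pair L k
  rw [List.getElem?_eq_getElem hk] at h1 h2
  simp only [encode, List.getD_eq_getElem?_getD, Nat.add_comm 1, List.getElem?_cons_succ, h1, h2]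
  exact ⟨rfl, rfl⟩

/-- The pair of `v` has number `v - 2` and begins at `1 + 2 * (v - 2) = 2 * v - 3`, as cell `0`
holds `n`. -/
theorem eq_encode_pairList {a : ℕ → ℕ} (h0 : a 0 = n)
    (h : ∀ v, 2 ≤ v → v < m → a (2 * v - 3) = v ∧ a (2 * v - 2) = g v) (i : ℕ)
    (hi : i < (encode n (pairList g m)).length) : a i = (encode n (pairList g m))[i] := by
  have hl : (pairList g m).length = m - 2 := by simp [pairList]
  rw [length_encode, hl] at hi
  rcases i with _ | i
  · exact h0
  · obtain ⟨k, hk⟩ : ∃ k, i = 2 * k ∨ i = 2 * k + 1 := ⟨i / 2, by omega⟩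
    have hkl : k < (pairList g m).length := by omega
    have hk' : (pairList g m)[k] = (2 + k, g (2 + k)) := by simp [pairList]
    have h1 := encode_getD n (pairList g m) hkl
    obtain ⟨h2, h3⟩ := h (2 + k) (by omega) (by omega)
    rw [hk'] at h1
    rcases hk with rfl | rfl
    · rw [← List.getD_eq_getElem (d := 0), Nat.add_comm, h1.1, ← h2]
      congr 1
      omega
    · rw [← List.getD_eq_getElem (d := 0), show 2 * k + 1 + 1 = 1 + 2 * k + 1 by omega, h1.2,
        ← h3]
      congr 1
      omega

end

/-! ### The programs -/

section

variable {n m W : ℕ} {g : ℕ → ℕ} {L : List (ℕ × ℕ)} {s : Store}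

theorem Store.setVar_var_self (s : Store) (d x : ℕ) : (s.setVar d x).var d = x :=
  Function.update_self _ _ _

theorem Store.setVar_var_of_ne (s : Store) {d v : ℕ} (x : ℕ) (h : v ≠ d) :
    (s.setVar d x).var v = s.var v := Function.update_of_ne h _ _

theorem Store.setVar_arr (s : Store) (d x : ℕ) : (s.setVar d x).arr = s.arr := rfl

theorem Store.setArr_var (s : Store) (k i x : ℕ) : (s.setArr k i x).var = s.var := rfl

theorem Store.setArr_arr_self (s : Store) (k i x : ℕ) :
    (s.setArr k i x).arr k = Function.update (s.arr k) i x := Function.update_self _ _ _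

theorem Store.setArr_arr_of_ne (s : Store) {k l : ℕ} (i x : ℕ) (h : l ≠ k) :
    (s.setArr k i x).arr l = s.arr l := Function.update_of_ne h _ _

attribute [local simp] Store.setVar_var_self Store.setVar_var_of_ne Store.setVar_arr
  Store.setArr_var Store.setArr_arr_self Store.setArr_arr_of_ne wp Cmd.block

/-- Variables `0`, `1`, `9` hold the constants `n`, `1`, `0`. -/
structure Constants (n : ℕ) (s : Store) : Prop where
  size : s.var 0 = n
  one : s.var 1 = 1
  zero : s.var 9 = 0

/-- Read the pairs in array `0` and store the map that they describe in array `1`. -/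
def readLoop : Cmd :=
  .whileLt 2 3 (.block [.rd 4 0 2, .add 2 2 1, .rd 5 0 2, .add 2 2 1, .wr 1 4 5])

/-- The invariant of the reading loop. -/
structure Reading (n m : ℕ) (g : ℕ → ℕ) (L : List (ℕ × ℕ)) (s : Store) : Prop
    extends Constants n s where
  limit : s.var 3 + 3 = 2 * m
  input : ∀ i, s.arr 0 i = (encode n L).getD i 0
  rest : ∀ k, 2 ≤ k → ∀ i, s.arr k i = 0
  done : ∃ k ≤ L.length, s.var 2 = 1 + 2 * k ∧
    ∀ v, s.arr 1 v = if v ∈ (L.take k).map Prod.fst then g v else 0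

/-- Each value is stored under its own index, so the order of the input plays no role and no sorting
is needed. -/
theorem readLoop_runs (hW : 10 * n + 10 ≤ W) (hm : 2 ≤ m) (hmn : m ≤ n + 1) (hL : Lists g m L)
    (hs : Reading n m g L s) :
    Runs (2 * n + 2) W readLoop s (18 * (2 * n + 2) + 2) fun s' => Reading n m g L s' ∧
      ∀ v, s'.arr 1 v = if 2 ≤ v ∧ v < m then g v else 0 := by
  have hlen := hL.length
  refine (Runs.whileLt_of_wp (I := Reading n m g L) (fun s => 2 * n + 3 - s.var 2)
    (m := 2 * n + 2) ?_ ?_ hs).mono ?_ ?_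
  · rintro s ⟨⟨h0, h1, h9⟩, h3, hin, hrest, k, hk, hvar, harr⟩ hlt
    have hk' : k < L.length := by omega
    obtain ⟨e1, e2⟩ := encode_getD n L hk'
    have hmem := (hL.2 L[k]).1 (List.getElem_mem hk')
    simp only [wp, Cmd.block]
    simp [h1, hvar, hin, -List.getD_eq_getElem?_getD, e1, e2]
    and_intros <;> try omega
    refine ⟨⟨by simpa using h0, by simpa using h1, by simpa using h9⟩, by simpa using h3,
        by simpa using hin, fun l hl i => ?_, k + 1, hk', ?_, fun v => ?_⟩
    · rw [Store.setArr_arr_of_ne _ _ _ (by omega)]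
      exact hrest l hl i
    · simp only [Store.setArr_var, Store.setVar_var_self]
      omega
    · simp only [Store.setArr_arr_self, Store.setVar_arr, Function.update_apply, harr,
        List.take_add_one, List.getElem?_eq_getElem hk', List.map_append, List.mem_append,
        Option.toList_some, List.map_cons, List.map_nil, List.mem_singleton]
      by_cases hv : v = L[k].1
      · simp [hv, hmem.2.2]
      · simp [hv]
  · have := hs.done
    omega
  · have : (Cmd.block [.rd 4 0 2, .add 2 2 1, .rd 5 0 2, .add 2 2 1, .wr 1 4 5]).size = 12 := rfl
    rw [this]
    omega
  · rintro s' ⟨hs', hlt⟩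
    refine ⟨hs', fun v => ?_⟩
    have h3 := hs'.limit
    obtain ⟨k, hk, hvar, harr⟩ := hs'.done
    rw [harr, List.take_of_length_le (by omega)]
    refine if_congr ?_ rfl rfl
    rw [List.mem_map]
    constructor
    · rintro ⟨p, hp, rfl⟩
      have := (hL.2 p).1 hp
      omega
    · intro hv
      exact ⟨(v, g v), (hL.2 _).2 ⟨hv.1, hv.2, rfl⟩, rfl⟩

/-- Write the pairs that array `1` describes to array `0`. -/
def writeLoop : Cmd :=
  .whileLt 5 3 (.block [.wr 0 2 5, .add 2 2 1, .rd 4 1 5, .wr 0 2 4, .add 2 2 1, .add 5 5 1])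

/-- The invariant of the writing loop. -/
structure Writing (n m : ℕ) (g : ℕ → ℕ) (s : Store) : Prop extends Constants n s where
  limit : s.var 3 = m
  map : s.arr 1 = g
  two_le : 2 ≤ s.var 5
  le : s.var 5 ≤ m
  pos : s.var 2 + 3 = 2 * s.var 5
  head : s.arr 0 0 = n
  done : ∀ v, 2 ≤ v → v < s.var 5 → s.arr 0 (2 * v - 3) = v ∧ s.arr 0 (2 * v - 2) = g v

theorem writeLoop_runs (hW : 10 * n + 10 ≤ W) (hmn : m ≤ n + 1) (hs : Writing n m g s) :
    Runs (2 * n + 2) W writeLoop s (18 * n + 2) fun s' => s'.arr 0 0 = n ∧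
      ∀ v, 2 ≤ v → v < m → s'.arr 0 (2 * v - 3) = v ∧ s'.arr 0 (2 * v - 2) = g v := by
  refine (Runs.whileLt_of_wp (I := Writing n m g) (fun s => n + 2 - s.var 5)
    (m := n) ?_ ?_ hs).mono ?_ ?_
  · rintro s ⟨⟨h0, h1, h9⟩, h3, hg, h2, hle, hpos, hhead, hdone⟩ hlt
    simp [h1, hg]
    and_intros <;> try omega
    refine ⟨⟨by simpa using h0, by simpa using h1, by simpa using h9⟩, by simpa using h3,
        by simpa using hg, ?_, ?_, ?_, ?_, fun v hv hv' => ?_⟩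
    · simp only [Store.setVar_var_self]; omega
    · simp only [Store.setVar_var_self]; omega
    · simp; omega
    · simp only [Store.setArr_arr_self, Store.setVar_arr, Function.update_apply]
      rw [if_neg (by omega), if_neg (by omega), hhead]
    · simp only [Store.setVar_var_self] at hv'
      simp only [Store.setArr_arr_self, Store.setVar_arr, Function.update_apply]
      by_cases hv5 : v = s.var 5
      · rw [if_neg (by omega), if_pos (by omega), if_pos (by omega), hv5]
        exact ⟨rfl, rfl⟩
      · rw [if_neg (by omega), if_neg (by omega), if_neg (by omega), if_neg (by omega)]
        exact hdone v hv (by omega)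
  · have := hs.two_le
    omega
  · have : (Cmd.block [.wr 0 2 5, .add 2 2 1, .rd 4 1 5, .wr 0 2 4, .add 2 2 1,
      .add 5 5 1]).size = 13 := rfl
    rw [this]
    omega
  · rintro s' ⟨hs', hlt⟩
    have h3 := hs'.limit
    exact ⟨hs'.head, fun v hv hv' => hs'.done v hv (by omega)⟩

/-- Mark the periodic points of the map in array `1` in array `3`, colouring vertices in
array `2`. -/
def searchLoop : Cmd :=
  .whileLt 5 0 (.block [.rd 7 2 6,
    .ifEq 7 9 (.block [.wr 2 6 5, .rd 6 1 6])
      (.block [.rd 8 3 6,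
        .ifEq 7 5
          (.ifEq 8 9 (.block [.wr 3 6 1, .rd 6 1 6]) (.block [.add 5 5 1, .add 6 5 9]))
          (.block [.add 5 5 1, .add 6 5 9])])])

/-- The invariant of the searching loop. -/
structure Searching (n : ℕ) (g : ℕ → ℕ) (s : Store) : Prop extends Constants n s where
  head : s.arr 0 0 = n
  map : s.arr 1 = g
  search : Search n g (s.var 5) (s.var 6) (s.arr 2) (s.arr 3)

/-- Every round colours a vertex, marks a vertex or advances the starting vertex, so the rounds
number at most `3 * n + 2`. -/
theorem searchLoop_runs (hn : 2 ≤ n) (hW : 10 * n + 10 ≤ W) (hg : Good n g n)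
    (hs : Searching n g s) :
    Runs (2 * n + 2) W searchLoop s (46 * (3 * n + 2) + 2) fun s' => Constants n s' ∧
      s'.arr 0 0 = n ∧ s'.arr 1 = g ∧ ∀ u, 2 ≤ u → (s'.arr 3 u ≠ 0 ↔ Per g u) := by
  refine (Runs.whileLt_of_wp (I := Searching n g)
    (fun s => zeros n (s.arr 2) + zeros n (s.arr 3) + (n - s.var 5))
    (m := 3 * n + 2) ?_ ?_ hs).mono ?_ ?_
  · rintro s ⟨⟨h0, h1, h9⟩, hhead, hmap, hsearch⟩ hlt
    have hv := hsearch.v_le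
    have h2 := hsearch.two_le
    rw [h0] at hlt
    by_cases hcol : s.arr 2 (s.var 6) = 0
    · have hmu := zeros_update_lt (x := s.var 5) hv hcol (by omega)
      simp [h9, hcol, hmap]
      and_intros <;> try omega
      refine ⟨⟨by simpa using h0, by simpa using h1, by simpa using h9⟩, by simpa using hhead,
          by simpa using hmap, ?_⟩
      simpa using hsearch.colour_step hg.map hlt hcol
    · by_cases hcm : s.arr 2 (s.var 6) = s.var 5 ∧ s.arr 3 (s.var 6) = 0
      · have hmu := zeros_update_lt (x := 1) hv hcm.2 (by omega)
        have h5 : s.var 5 ≠ 0 := by omega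
        simp [h9, hcm.1, hcm.2, hmap, h1, h5]
        and_intros <;> try omega
        exact ⟨⟨by simpa using h0, by simpa using h1, by simpa using h9⟩, by simpa using hhead,
          by simpa using hmap, by simpa using hsearch.mark_step hg.map hlt hcm.1⟩
      · have hnext := hsearch.next_step hlt hcol (by tauto)
        have hfin : ∀ x y, Searching n g
            ((((s.setVar 7 x).setVar 8 y).setVar 5 (s.var 5 + 1)).setVar 6 (s.var 5 + 1)) :=
          fun x y => ⟨⟨by simpa using h0, by simpa using h1, by simpa using h9⟩,
            by simpa using hhead, by simpa using hmap, by simpa using hnext⟩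
        by_cases h5 : s.arr 2 (s.var 6) = s.var 5
        · have h6 : s.arr 3 (s.var 6) ≠ 0 := fun h6 => hcm ⟨h5, h6⟩
          have h7 : s.var 5 ≠ 0 := by omega
          simp [h9, h1, h5, h6, h7]
          and_intros <;> try omega
          exact hfin _ _
        · simp [h9, h1, hcol, h5]
          and_intros <;> try omega
          exact hfin _ _
  · have := zeros_le n (s.arr 2)
    have := zeros_le n (s.arr 3)
    have := hs.search.two_le
    omega
  · simp only [Cmd.block, Cmd.size]
    omega
  · rintro s' ⟨hs', hlt⟩
    have h1 := hs'.search.i_le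
    have h2 := hs'.size
    have h3 : s'.var 5 = n := by omega
    have h4 := hs'.search
    rw [h3] at h4
    exact ⟨hs'.toConstants, hs'.head, hs'.map, fun u hu => h4.mark_iff hg hu⟩

/-- Splice in the cycles of the map in array `1`, as described at `Splicing`. -/
def spliceLoop : Cmd :=
  .whileLt 1 5 (.ifLt 1 6
    (.block [.wr 3 6 9, .rd 6 1 6])
    (.block [.rd 7 3 5,
      .ifEq 7 9 .nop (.block [.rd 6 1 5, .wr 1 10 6, .wr 1 5 1, .add 10 5 9]),
      .sub 5 5 1]))

/-- The invariant of the splicing loop. -/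
structure SplicingStore (n : ℕ) (g₀ : ℕ → ℕ) (s : Store) : Prop extends Constants n s where
  head : s.arr 0 0 = n
  splicing : Splicing n g₀ (s.arr 1) (s.var 5) (s.var 10) (s.var 6) (s.arr 3)

/-- Erasing a mark and lowering `i` each consume a unit of the measure, and no mark is ever set
again; hence all the erasing together takes linear time. -/
theorem spliceLoop_runs (hW : 10 * n + 10 ≤ W) (hs : SplicingStore n g s) :
    Runs (2 * n + 2) W spliceLoop s (40 * (2 * n + 2) + 2) fun s' => Constants n s' ∧
      s'.arr 0 0 = n ∧ Acyclic (s'.arr 1) ∧ ∃ p, Chain n (g, n) (s'.arr 1, p) := by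
  refine (Runs.whileLt_of_wp (I := SplicingStore n g)
    (fun s => nonzeros n (s.arr 3) + s.var 5) (m := 2 * n + 2) ?_ ?_ hs).mono ?_ ?_
  · rintro s ⟨⟨h0, h1, h9⟩, hhead, hsp⟩ hlt
    have hv := hsp.v_le
    have hp := hsp.lt
    have hpn := hsp.good.le
    rw [h1] at hlt
    by_cases hv1 : 1 < s.var 6
    · obtain ⟨hm, hc⟩ := hsp.clear_step hv1
      have hmu := nonzeros_update_lt hv hm
      simp [h9, h1, hv1]
      and_intros <;> try omega
      exact ⟨⟨by simpa using h0, by simpa using h1, by simpa using h9⟩, by simpa using hhead,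
        by simpa using hc⟩
    · by_cases hm : s.arr 3 (s.var 5) = 0
      · have hskip := hsp.skip_step hv1 hlt hm
        simp [h9, h1, hv1, hm]
        and_intros <;> try omega
        exact ⟨⟨by simpa using h0, by simpa using h1, by simpa using h9⟩, by simpa using hhead,
          by simpa using hskip⟩
      · have hsplice := hsp.splice_step hv1 hlt hm
        simp [h9, h1, hv1, hm]
        and_intros <;> try omega
        exact ⟨⟨by simpa using h0, by simpa using h1, by simpa using h9⟩, by simpa using hhead,
          by simpa using hsplice⟩
  · have := nonzeros_le n (s.arr 3)
    have := hs.splicing.lt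
    have := hs.splicing.good.le
    omega
  · simp only [Cmd.block, Cmd.size]
    omega
  · rintro s' ⟨hs', hlt⟩
    rw [hs'.one] at hlt
    exact ⟨hs'.toConstants, hs'.head, hs'.splicing.acyclic hlt, _, hs'.splicing.chain⟩

/-- Put the vertices on the path from `n` to `1` on the stack in array `4`. -/
def stackLoop : Cmd :=
  .whileLt 1 6 (.block [.wr 4 5 6, .rd 6 1 6, .add 5 5 1])

/-- The invariant of the stacking loop. -/
structure Stacking (n : ℕ) (g : ℕ → ℕ) (s : Store) : Prop extends Constants n s where
  head : s.arr 0 0 = n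
  map : s.arr 1 = g
  one_le : 1 ≤ s.var 6
  cur : s.var 6 = g^[s.var 5] n
  stack : ∀ k < s.var 5, s.arr 4 k = g^[k] n ∧ 2 ≤ g^[k] n

theorem stackLoop_runs (hW : 10 * n + 10 ≤ W) (hmap : IsMap n g) (hac : Acyclic g)
    (hs : Stacking n g s) :
    Runs (2 * n + 2) W stackLoop s (18 * (n + 1) + 2) fun s' => Stacking n g s' ∧
      s'.var 6 = 1 := by
  refine (Runs.whileLt_of_wp (I := Stacking n g)
    (fun s => n + 1 - s.var 5) (m := n + 1) ?_ ?_ hs).mono ?_ ?_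
  · rintro s ⟨⟨h0, h1, h9⟩, hhead, hg, hone, hcur, hstack⟩ hlt
    rw [h1] at hlt
    have hj := hac.le_of_iterate hmap (hcur ▸ hlt)
    have hv : s.var 6 ≤ n := hmap.reach_le ⟨_, hcur.symm⟩ le_rfl
    simp [h1, hg]
    and_intros <;> try omega
    refine ⟨⟨by simpa using h0, by simpa using h1, by simpa using h9⟩, by simpa using hhead,
      by simpa using hg, ?_, ?_, fun k hk => ?_⟩
    · simpa using hmap.pos _ hlt hv
    · simp [hcur, Function.iterate_succ_apply']
    · simp only [Store.setVar_var_self] at hk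
      by_cases hk' : k = s.var 5
      · subst hk'
        simpa [hcur] using hcur ▸ hlt
      · simpa [Function.update_of_ne hk'] using hstack k (by omega)
  · omega
  · simp only [Cmd.block, Cmd.size]
    omega
  · rintro s' ⟨hs', hlt⟩
    have := hs'.one
    have := hs'.one_le
    exact ⟨hs', by omega⟩

/-- Cut off the cycles from the path on the stack, as described at `Cutting`. -/
def cutLoop : Cmd :=
  .whileLt 9 5 (.block [.sub 5 5 1, .rd 6 4 5,
    .ifLt 10 6 (.block [.rd 7 1 6, .wr 1 10 7, .wr 1 6 1, .add 10 6 9]) .nop])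

/-- The invariant of the cutting loop. -/
structure CuttingStore (n : ℕ) (t : ℕ → ℕ) (q : ℕ) (s : Store) : Prop
    extends Constants n s where
  head : s.arr 0 0 = n
  cutting : Cutting n t q (s.arr 1) (s.var 10) (s.var 5) (s.arr 4)

theorem cutLoop_runs {q : ℕ} (hW : 10 * n + 10 ≤ W) (hs : CuttingStore n g q s)
    (hj : s.var 5 ≤ n) :
    Runs (2 * n + 2) W cutLoop s (40 * n + 2) fun s' => Constants n s' ∧ s'.arr 0 0 = n ∧
      Chain n (s'.arr 1, n) (g, q) := by
  refine (Runs.whileLt_of_wp (I := fun s => CuttingStore n g q s ∧ s.var 5 ≤ n)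
    (fun s => s.var 5) (m := n) ?_ hj ⟨hs, hj⟩).mono ?_ ?_
  · rintro s ⟨⟨⟨h0, h1, h9⟩, hhead, hc⟩, hj⟩ hlt
    rw [h9] at hlt
    obtain ⟨j, hj'⟩ : ∃ j, s.var 5 = j + 1 := ⟨s.var 5 - 1, by omega⟩
    rw [hj'] at hc
    have hpn := hc.good.le
    by_cases hx : s.var 10 < s.arr 4 j
    · have hcut := hc.cut_step hx
      have hxn := hcut.good.le
      simp [h9, h1, hj', hx]
      and_intros <;> try omega
      · exact ⟨⟨by simpa using h0, by simpa using h1, by simpa using h9⟩, by simpa using hhead,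
          by simpa using hcut⟩
    · have hskip := hc.skip_step (not_lt.1 hx)
      simp [h9, h1, hj', hx]
      and_intros <;> try omega
      · exact ⟨⟨by simpa using h0, by simpa using h1, by simpa using h9⟩, by simpa using hhead,
          by simpa using hskip⟩
  · simp only [Cmd.block, Cmd.size]
    omega
  · rintro s' ⟨⟨hs', hj⟩, hlt⟩
    rw [hs'.zero] at hlt
    have hc := hs'.cutting
    rw [show s'.var 5 = 0 by omega] at hc
    exact ⟨hs'.toConstants, hs'.head, hc.eq_of_zero ▸ hc.chain⟩

end

section

variable {n W : ℕ} {L : List (ℕ × ℕ)}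

attribute [local simp] Store.setVar_var_self Store.setVar_var_of_ne Store.setVar_arr
  Store.setArr_var Store.setArr_arr_self Store.setArr_arr_of_ne wp Cmd.block

/-- A command that computes `Θ`. -/
def thetaCmd : Cmd :=
  .seq (.block [.set 1 1, .set 2 1, .add 3 0 0, .set 4 3, .sub 3 3 4]) <|
  .seq readLoop <|
  .seq (.block [.wr 1 0 1, .set 5 2, .set 6 2]) <|
  .seq searchLoop <|
  .seq (.block [.sub 5 0 1, .set 6 1, .add 10 0 9]) <|
  .seq spliceLoop <|
  .seq (.block [.add 3 0 1, .set 5 2, .set 2 1]) writeLoop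

/-- A command that computes the inverse of `Θ`. -/
def thetaInvCmd : Cmd :=
  .seq (.block [.set 1 1, .set 2 1, .add 3 0 0, .sub 3 3 1]) <|
  .seq readLoop <|
  .seq (.block [.set 5 0, .add 6 0 9]) <|
  .seq stackLoop <|
  .seq (.block [.sub 5 5 1, .rd 10 4 5]) <|
  .seq cutLoop <|
  .seq (.block [.add 3 0 9, .set 5 2, .set 2 1]) writeLoop

/-! ### Correctness and running time of the two programs -/

theorem thetaCmd_runs (hn : 2 ≤ n) (hW : 10 * n + 10 ≤ W) (f : FunClass n) {t : ℕ → ℕ}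
    (ht : IsMap n t) (hft : theta f = digraphOf n t) (hL : Lists (extend f) n L) :
    Runs (2 * n + 2) W thetaCmd (initialStore n (encode n L)) (500 * n) fun s =>
      s.arr 0 0 = n ∧ ∀ v, 2 ≤ v → v < n + 1 →
        s.arr 0 (2 * v - 3) = v ∧ s.arr 0 (2 * v - 2) = t v := by
  have hgood := extend_good hn f
  refine Runs.mono (p := thetaCmd) (Runs.seq (wp.runs (Q := Reading n n (extend f) L) ?_)
    fun s hs =>
      (readLoop_runs hW hn (by omega) hL hs).seq fun s hs =>
      (wp.runs (Q := Searching n (extend f)) ?_).seq fun s hs =>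
      (searchLoop_runs hn hW hgood hs).seq fun s hs =>
      (wp.runs (Q := SplicingStore n (extend f)) ?_).seq fun s hs =>
      (spliceLoop_runs hW hs).seq fun s hs =>
      (wp.runs (Q := Writing n (n + 1) t) ?_).seq fun s hs => writeLoop_runs hW le_rfl hs) ?_
    fun s hs => hs
  · simp [initialStore]
    and_intros <;> try omega
    exact ⟨⟨by simp, by simp, by simp⟩, by simp; omega, by simp, fun k hk i => by
      simp [show k ≠ 0 by omega], 0, Nat.zero_le _, by simp, by simp⟩
  · obtain ⟨⟨⟨h0, h1, h9⟩, h3, hin, hrest, hpos⟩, harr⟩ := hs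
    simp [h0, h1]
    and_intros <;> try omega
    refine ⟨⟨by simpa using h0, by simpa using h1, by simpa using h9⟩, ?_, ?_, ?_⟩
    · simp [hin, encode]
    -- Writing `1` into entry `n` turns the map that was read into `extend f`.
    · funext v
      simp only [Store.setVar_arr, Store.setArr_arr_self, Function.update_apply, harr]
      split_ifs with hv hv'
      · rw [hv, extend_self]
      · rfl
      · simp only [extend]
        rw [dif_neg hv', if_neg hv]
    · have h2 : s.arr 2 = fun _ => 0 := funext (hrest 2 (by omega))
      have h3 : s.arr 3 = fun _ => 0 := funext (hrest 3 (by omega))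
      simpa [h2, h3] using Search.init hn
  · obtain ⟨⟨h0, h1, h9⟩, hhead, harr, hmark⟩ := hs
    simp [h0, h1, h9]
    and_intros <;> try omega
    exact ⟨⟨by simpa using h0, by simpa using h1, by simpa using h9⟩, by simpa using hhead,
      by simpa [harr] using Splicing.init hn hgood hmark⟩
  · obtain ⟨⟨h0, h1, h9⟩, hhead, hac, p, hc⟩ := hs
    have harr : s.arr 1 = t := digraphOf_injective (hc.good hgood).map ht
      (by rw [← hft, theta_eq_digraphOf hn f hc hac])
    simp [h0, h1]
    and_intros <;> try omega
    exact ⟨⟨by simpa using h0, by simpa using h1, by simpa using h9⟩, by simp, by simpa using harr,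
      by simp, by simp; omega, by simp, by simpa using hhead, fun v hv hv' => by simp at hv'; omega⟩
  · simp only [Cmd.block, Cmd.size]
    omega

theorem thetaInvCmd_runs (hn : 2 ≤ n) (hW : 10 * n + 10 ≤ W) (f : FunClass n) {t : ℕ → ℕ}
    (ht : IsMap n t) (hft : theta f = digraphOf n t) (hL : Lists t (n + 1) L) :
    Runs (2 * n + 2) W thetaInvCmd (initialStore n (encode n L)) (500 * n) fun s =>
      s.arr 0 0 = n ∧ ∀ v, 2 ≤ v → v < n →
        s.arr 0 (2 * v - 3) = v ∧ s.arr 0 (2 * v - 2) = extend f v := by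
  have hgood := extend_good hn f
  obtain ⟨t', p, hchain, hac, hmap, hft'⟩ := exists_theta_eq hn f
  obtain rfl : t' = t := digraphOf_injective hmap ht (hft' ▸ hft)
  refine Runs.mono (p := thetaInvCmd) (Runs.seq (wp.runs (Q := Reading n (n + 1) t' L) ?_)
    fun s hs =>
      (readLoop_runs hW (by omega) le_rfl hL hs).seq fun s hs =>
      (wp.runs (Q := Stacking n t') ?_).seq fun s hs =>
      (stackLoop_runs hW hmap hac hs).seq fun s hs =>
      (wp.runs (Q := fun s => CuttingStore n t' p s ∧ s.var 5 ≤ n) ?_).seq fun s hs =>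
      (cutLoop_runs hW hs.1 hs.2).seq fun s hs =>
      (wp.runs (Q := Writing n n (extend f)) ?_).seq fun s hs => writeLoop_runs hW (by omega) hs) ?_
    fun s hs => hs
  · simp [initialStore]
    and_intros <;> try omega
    exact ⟨⟨by simp, by simp, by simp⟩, by simp; omega, by simp, fun k hk i => by
      simp [show k ≠ 0 by omega], 0, Nat.zero_le _, by simp, by simp⟩
  · obtain ⟨⟨⟨h0, h1, h9⟩, h3, hin, hrest, hpos⟩, harr⟩ := hs
    simp [h0, h9]
    and_intros <;> try omega
    refine ⟨⟨by simpa using h0, by simpa using h1, by simpa using h9⟩, ?_, ?_, ?_, ?_, ?_⟩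
    · simp [hin, encode]
    · funext v
      simp only [Store.setVar_arr, harr]
      split_ifs with hv
      · rfl
      · rcases lt_or_ge n v with h6 | h6
        · exact (hmap.big v h6).symm
        · obtain rfl | rfl : v = 0 ∨ v = 1 := by omega
          · exact hmap.zero.symm
          · exact hmap.one.symm
    · simp; omega
    · simp
    · simp
  · obtain ⟨⟨⟨h0, h1, h9⟩, hhead, harr, hone, hcur, hstack⟩, hv⟩ := hs
    simp [h1]
    have hpos : s.var 5 ≠ 0 := fun h5 => by
      rw [h5, hv] at hcur
      simp only [Function.iterate_zero, id] at hcur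
      omega
    have hcut := Cutting.init (stk := s.arr 4) (j := s.var 5 - 1) hmap hac
      (fun k hk => hstack k (by omega))
      (by rw [Nat.sub_add_cancel (by omega), ← hcur, hv])
    have hj := hac.le_of_iterate hmap (hstack (s.var 5 - 1) (by omega)).2
    -- The top of the stack is the vertex `p` at which the chain of splicings from `f` ends, so the
    -- chain obtained by cutting has the same end and, by `Chain.start_unique`, the same start.
    obtain rfl := hcut.good.unique (hchain.good hgood)
    and_intros <;> try omega
    exact ⟨⟨by simpa using h0, by simpa using h1, by simpa using h9⟩, by simpa using hhead,
      by simpa [harr] using hcut⟩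
  · obtain ⟨⟨h0, h1, h9⟩, hhead, hc⟩ := hs
    have harr : s.arr 1 = extend f := Chain.start_unique hc hchain
    simp [h0, h9]
    and_intros <;> try omega
    exact ⟨⟨by simpa using h0, by simpa using h1, by simpa using h9⟩, by simp, by simpa using harr,
      by simp, by simp; omega, by simp, by simpa using hhead, fun v hv hv' => by simp at hv'; omega⟩
  · simp only [Cmd.block, Cmd.size]
    omega

/-- Five arrays of length `2 * n + 2` account for `10 * n + 10`; the passage from `500 * n` to `600
* n` absorbs the five initial instructions. -/
theorem computes_of_runs {p : Cmd} {m m' : ℕ} {G H : Digraph (Vertex n)} {g h : ℕ → ℕ}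
    (hn : 2 ≤ n) (hm : m ≤ n + 1) (hm' : m' ≤ n + 1) (hg : ∀ v, g v ≤ n)
    (hG : ∀ L, IsEdgeList G L ↔ Lists g m L) (hH : ∀ L, IsEdgeList H L ↔ Lists h m' L)
    (hp : ∀ W, 10 * n + 10 ≤ W → ∀ L, Lists g m L →
      Runs (2 * n + 2) W p (initialStore n (encode n L)) (500 * n) fun s =>
        s.arr 0 0 = n ∧ ∀ v, 2 ≤ v → v < m' →
          s.arr 0 (2 * v - 3) = v ∧ s.arr 0 (2 * v - 2) = h v) :
    Computes (program p) G H (600 * n) (600 * n) := by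
  intro L hL
  rw [hG] at hL
  refine ⟨pairList h m', (hH _).2 (lists_pairList h m'), pairwise_pairList h m', ?_⟩
  have hrun := runsTo_program (W := 600 * n) (output := encode n (pairList h m')) (by simp [encode])
    (by rw [length_encode, hL.length]; omega) (by omega) ?_
    (by rw [length_encode, (lists_pairList h m').length]; omega) (hp (600 * n) (by omega) L hL)
    fun s hs => eq_encode_pairList hs.1 hs.2
  · obtain ⟨k, hk, hrest⟩ := hrun
    exact ⟨k, by omega, hrest⟩
  · intro x hx
    simp only [encode, List.mem_cons, List.mem_flatMap, List.not_mem_nil, or_false] at hx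
    rcases hx with rfl | ⟨q, hq, rfl | rfl⟩
    · omega
    · have := (hL.2 q).1 hq
      omega
    · have := (hL.2 q).1 hq
      have := hg q.1
      omega

end

end CayleyRAM

theorem mainTheorem5 :
    ∃ (P Q : CayleyRAM.Program) (C : ℕ), ∀ n : ℕ, 2 ≤ n →
      ∃ Θ : CayleyRAM.FunClass n ≃ CayleyRAM.rootedTrees n,
        (∀ f, (Θ f : Digraph (CayleyRAM.Vertex n)) = CayleyRAM.theta f) ∧
        (∀ f, CayleyRAM.Computes P (CayleyRAM.graph f) (Θ f).1 (C * n) (C * n)) ∧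
        (∀ T, CayleyRAM.Computes Q T.1 (CayleyRAM.graph (Θ.symm T)) (C * n) (C * n)) := by
  open CayleyRAM in
  refine ⟨program thetaCmd, program thetaInvCmd, 600, fun n hn =>
    ⟨thetaEquiv hn, fun _ => rfl, fun f => ?_, fun T => ?_⟩⟩
  · obtain ⟨t, -, -, -, ht, hft⟩ := exists_theta_eq hn f
    have h1 : ((thetaEquiv hn f).1 : Digraph (Vertex n)) = digraphOf n t := hft
    rw [h1]
    exact computes_of_runs hn (by omega) le_rfl (extend_isMap hn f).le
      (fun _ => isEdgeList_graph hn f) (fun _ => isEdgeList_digraphOf ht)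
      fun W hW L hL => thetaCmd_runs hn hW f ht hft hL
  · obtain ⟨f, rfl⟩ := (thetaEquiv hn).surjective T
    obtain ⟨t, -, -, -, ht, hft⟩ := exists_theta_eq hn f
    have h1 : ((thetaEquiv hn f).1 : Digraph (Vertex n)) = digraphOf n t := hft
    rw [h1, Equiv.symm_apply_apply]
    exact computes_of_runs hn le_rfl (by omega) ht.le
      (fun _ => isEdgeList_digraphOf ht) (fun _ => isEdgeList_graph hn f)
      fun W hW L hL => thetaInvCmd_runs hn hW f ht hft hL
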